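/- **Conventions.** For a rational number $r=p/q$ in lowest terms ($q>0$) put $\langle r\rangle := 1+\lceil\log_2(|p|+1)\rceil+\lceil\log_2(q+1)\rceil$. A rational vector of length $n$ or an $m\times n$ matrix has bit-size equal to the number of its entries plus the sum of the bit-sizes of its entries, and $\langle A,B\rangle:=\langle A\rangle+\langle B\rangle$. A *branching proof* (of integer infeasibility) for a convex set $K\subseteq\mathbb R^n$ is a finite rooted binary tree $\mathcal T$ in which every non-leaf node $v$ is labelled with some $(\mathbf a_v,b_v)\in\mathbb Z^n\times\mathbb Z$ and has two children, the left edge being labelled with the inequality $\mathbf a_v\mathbf x\le b_v$ and the right edge with $-\mathbf a_v\mathbf x\le -b_v-1$, such that for every leaf $v$ the set $K_v$ of those $\mathbf x\in K$ that satisfy all inequalities on the path from the root to $v$ is empty. Its length $|\mathcal T|$ is its number of nodes. Let $K=\{\mathbf x\in\mathbb R^n:\mathsf C\mathbf x\le\mathbf d\}$ with $\mathsf C\in\mathbb Q^{m\times n}$, $\mathbf d\in\mathbb Q^m$. A *certified* branching proof for $K$ is a branching proof for $K$ in which every leaf $v$ is moreover labelled with a Farkas certificate, i.e. a vector $\boldsymbol\lambda_v=(\boldsymbol\lambda_{v,1},\boldsymbol\lambda_{v,2})\in\mathbb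 Q^{m+m_v}$, $\boldsymbol\lambda_v\ge 0$, with $\boldsymbol\lambda_{v,1}\mathsf C+\boldsymbol\lambda_{v,2}\mathsf A_v=0$ and $\boldsymbol\lambda_{v,1}\mathbf d+\boldsymbol\lambda_{v,2}\mathbf b_v<0$, where $\mathsf A_v\mathbf x\le\mathbf b_v$ is the system of the $m_v$ inequalities on the path from the root to $v$. The certificates are written sparsely, as the list of pairs (position $i\in\{1,\dots,m+m_v\}$, value $\lambda_{v,i}$) over the non-zero entries, with bit-size $\sum_{i:\lambda_{v,i}\ne0}(1+\langle i\rangle+\langle\lambda_{v,i}\rangle)$. The bit-size $\langle\mathcal T\rangle$ of a certified branching proof is the number of its nodes, plus the number of its edges, plus the bit-sizes $\langle\mathbf a_v,b_v\rangle$ of the labels of all inner nodes, plus the bit-sizes of the labels (inequalities) of all edges, plus the bit-sizes of the certificates at all leaves. **Statement.** There is an absolute constant $c$ such that the following holds. Let $n\ge1$, let $K=\{\mathbf x\in\mathbb R^n:\mathsf C\mathbf x\le\mathbf d\}$ be a rational polytope (i.e. bounded), $\mathsf C\in\mathbb Q^{m\times n}$, $\mathbf d\in\mathbb Q^m$, of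 bit-size $L:=\langle\mathsf C,\mathbf d\rangle$, and let $\mathcal T$ be a branching proof for $K$. Then there is a certified branching proof $\mathcal T'$ for $K$ such that $$|\mathcal T'|\le c\,n\,|\mathcal T|\qquad\text{and}\qquad \langle\mathcal T'\rangle\le c\,n^6L\,|\mathcal T|.$$ -/

import Mathlib

namespace BranchingProofs

/-! ### Bit-sizes -/

/-- Bit-size of a rational `p / q` in lowest terms, `q > 0`:
`1 + ⌈log₂ (|p| + 1)⌉ + ⌈log₂ (q + 1)⌉` (`Nat.clog 2` is the rounded-up base-2 logarithm). -/
def bitsRat (r : ℚ) : ℕ := 1 + Nat.clog 2 (r.num.natAbs + 1) + Nat.clog 2 (r.den + 1)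

/-- Bit-size of a rational vector: its length plus the bit-sizes of all entries. -/
def bitsVec {n : ℕ} (c : Fin n → ℚ) : ℕ := n + ∑ i, bitsRat (c i)

/-- Bit-size of a rational matrix: the number of entries plus the bit-sizes of all entries. -/
def bitsMat {m n : ℕ} (A : Matrix (Fin m) (Fin n) ℚ) : ℕ := m * n + ∑ i, ∑ j, bitsRat (A i j)

/-- Bit-size of a sparsely written vector: the list of the pairs (position, value) of its non-zero
entries. Each such entry costs one bit, plus the bit-sizes of its (1-based) position and of its
value. -/
def bitsSparse {k : ℕ} (lam : Fin k → ℚ) : ℕ :=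
  ∑ i, if lam i = 0 then 0 else 1 + bitsRat ((i : ℕ) + 1 : ℚ) + bitsRat (lam i)

/-! ### Linear inequalities and polyhedra -/

/-- The integer inequality `a x ≤ b`, with `a ∈ ℤⁿ` and `b ∈ ℤ`. -/
structure Ineq (n : ℕ) where
  a : Fin n → ℤ
  b : ℤ

/-- The halfspace of `ℝⁿ` defined by an inequality. -/
def Ineq.halfspace {n : ℕ} (e : Ineq n) : Set (Fin n → ℝ) := {x | ∑ j, (e.a j : ℝ) * x j ≤ e.b}

/-- The bit-size of an inequality. -/
def Ineq.bits {n : ℕ} (e : Ineq n) : ℕ := bitsVec (fun j => (e.a j : ℚ)) + bitsRat (e.b : ℚ)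

/-- Label `a x ≤ b` of the left edge of the disjunction `(a, b)`. -/
def leftIneq {n : ℕ} (a : Fin n → ℤ) (b : ℤ) : Ineq n := ⟨a, b⟩

/-- Label `-a x ≤ -b - 1`, that is `a x ≥ b + 1`, of the right edge of the disjunction `(a, b)`. -/
def rightIneq {n : ℕ} (a : Fin n → ℤ) (b : ℤ) : Ineq n := ⟨-a, -b - 1⟩

/-- The rational polyhedron `{x ∈ ℝⁿ : C x ≤ d}`. -/
def polyhedron {m n : ℕ} (C : Matrix (Fin m) (Fin n) ℚ) (d : Fin m → ℚ) : Set (Fin n → ℝ) :=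
  {x | ∀ i, ∑ j, (C i j : ℝ) * x j ≤ (d i : ℝ)}

/-! ### Branching proofs -/

/-- Rooted binary trees whose inner nodes are labelled with integer disjunctions `(a, b)`;
the first subtree hangs on the edge `a x ≤ b`, the second one on the edge `a x ≥ b + 1`. -/
inductive BranchTree (n : ℕ) : Type
  | leaf : BranchTree n
  | node (a : Fin n → ℤ) (b : ℤ) (left right : BranchTree n) : BranchTree n

/-- The length of a tree: its number of nodes, leaves included. -/
def BranchTree.length {n : ℕ} : BranchTree n → ℕ
  | .leaf => 1
  | .node _ _ l r => 1 + l.length + r.length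

/-- `T` is a branching proof of integer infeasibility for `K`: the continuous relaxation at every
leaf, i.e. `K` cut by all inequalities on the path from the root to the leaf, is empty. -/
def IsBranchingProof {n : ℕ} : Set (Fin n → ℝ) → BranchTree n → Prop
  | K, .leaf => K = ∅
  | K, .node a b l r =>
      IsBranchingProof (K ∩ (leftIneq a b).halfspace) l ∧
      IsBranchingProof (K ∩ (rightIneq a b).halfspace) r

/-! ### Certified branching proofs -/

/-- Subtrees, rooted at depth `k`, of trees in which every leaf is labelled with a vector of
multipliers: one multiplier for each of the `m` inequalities of the polyhedron, followed by one for
each edge on the path from the root of the whole tree to the leaf. -/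
inductive CertTree (n m : ℕ) : ℕ → Type
  | leaf {k : ℕ} (lam : Fin (m + k) → ℚ) : CertTree n m k
  | node {k : ℕ} (a : Fin n → ℤ) (b : ℤ) (left right : CertTree n m (k + 1)) : CertTree n m k

/-- The tree without the multipliers. -/
def CertTree.toBranchTree {n m : ℕ} : {k : ℕ} → CertTree n m k → BranchTree n
  | _, .leaf _ => .leaf
  | _, .node a b l r => .node a b l.toBranchTree r.toBranchTree

/-- `lam = (lam₁, lam₂)` is a Farkas certificate of infeasibility for the system `C x ≤ d`,
`a_e x ≤ b_e` for the `k` inequalities `e` of `E`. -/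
def IsFarkasCertificate {n m k : ℕ} (C : Matrix (Fin m) (Fin n) ℚ) (d : Fin m → ℚ)
    (E : Fin k → Ineq n) (lam : Fin (m + k) → ℚ) : Prop :=
  (∀ i, 0 ≤ lam i) ∧
  (∀ j, ∑ i, lam (Fin.castAdd k i) * C i j + ∑ e, lam (Fin.natAdd m e) * ((E e).a j : ℚ) = 0) ∧
  ∑ i, lam (Fin.castAdd k i) * d i + ∑ e, lam (Fin.natAdd m e) * ((E e).b : ℚ) < 0

/-- All leaves below a node are labelled with Farkas certificates, where `E` lists the inequalities
on the path from the root to that node. -/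
def CertTree.LeavesCertified {n m : ℕ} (C : Matrix (Fin m) (Fin n) ℚ) (d : Fin m → ℚ) :
    {k : ℕ} → (Fin k → Ineq n) → CertTree n m k → Prop
  | _, E, .leaf lam => IsFarkasCertificate C d E lam
  | _, E, .node a b l r =>
      l.LeavesCertified C d (Fin.snoc E (leftIneq a b)) ∧
      r.LeavesCertified C d (Fin.snoc E (rightIneq a b))

/-- `T` is a certified branching proof of integer infeasibility for `{x : C x ≤ d}`. -/
def IsCertifiedBranchingProof {n m : ℕ} (C : Matrix (Fin m) (Fin n) ℚ) (d : Fin m → ℚ)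
    (T : CertTree n m 0) : Prop :=
  IsBranchingProof (polyhedron C d) T.toBranchTree ∧ T.LeavesCertified C d Fin.elim0

/-- Bit-size of a certified branching proof as a labelled rooted tree: one for each node and each
edge, plus the bit-sizes of all edge labels (inequalities) and of all node labels (disjunctions at
the inner nodes, multipliers, sparsely written, at the leaves). -/
def CertTree.bits {n m : ℕ} : {k : ℕ} → CertTree n m k → ℕ
  | _, .leaf lam => 1 + bitsSparse lam
  | _, .node a b l r =>
      (1 + (bitsVec (fun j => (a j : ℚ)) + bitsRat (b : ℚ))) +
      (1 + (leftIneq a b).bits + l.bits) +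
      (1 + (rightIneq a b).bits + r.bits)

end BranchingProofs

namespace BranchingProofs

/-! ### Farkas' lemma -/

/-! The obstacle is that the labels of a given proof may have arbitrarily large entries. Every
disjunction is therefore replaced by one with entries of `O(n³L)` bits, and the leaves are repaired
afterwards. With `x̂ = (x, -1)` and `z = (a, b)` the two branches read `z·x̂ ≤ 0` and `z·x̂ ≥ 1`.
Repeated Dirichlet approximation peels off from `z` bounded integral directions at decreasing
scales; the substitute `p'` combines the same directions with bounded weights of the same hierarchy.
A substituted branch need not imply the original one, but it leaves only this alternative, on the
orthogonal complement of any subspace `V` (`exists_substitution`): either the original inequality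
holds, or some bounded integral `p ∉ V` satisfies `p·x̂ ≤ δ` and dominates the violation through `γ
(p·x̂ + δ)`. At a leaf, a Farkas certificate with at most `n + 1` nonzero multipliers says that a
positive combination of the original functionals is positive at every point of the substituted
region. The heaviest term then has `-1 < p·x̂ < 1`. Branching on `p` leaves only `p·x̂ = 0`, and `p`
joins `V`. After at most `n + 1` rounds `V` is the whole space, which is absurd since the last
coordinate of `x̂` is `-1` (`exists_refutation`). Each original node thus costs `O(n)` new ones.
Sizes rest on three facts. A Farkas certificate of minimal support is unique up to scaling, so
Siegel's lemma makes it integral and small, independently of the right-hand sides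
(`exists_sparse_farkas`). The same independence bounds the polytope by a box of radius `2 ^ (6nL)`
(`abs_le_of_mem_polyhedron`). Bounded labels allow only finitely many inequalities; omitting
repetitions along paths bounds the depth, so a position in a sparse certificate costs `O(n⁴L)` bits
whatever `|T|` is (`exists_pruned`). -/

theorem exists_between_of_forall_le {α β : Type} [Fintype α] [Fintype β] (f : α → ℚ) (g : β → ℚ)
    (h : ∀ i j, f i ≤ g j) : ∃ t, (∀ i, f i ≤ t) ∧ ∀ j, t ≤ g j := by
  classical
  rcases isEmpty_or_nonempty α with hα | hα
  · rcases isEmpty_or_nonempty β with hβ | hβ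
    · exact ⟨0, fun i => isEmptyElim i, fun j => isEmptyElim j⟩
    · obtain ⟨j, hj⟩ := Finite.exists_min g
      exact ⟨g j, fun i => isEmptyElim i, hj⟩
  · obtain ⟨i, hi⟩ := Finite.exists_max f
    exact ⟨f i, hi, h i⟩

/-- Farkas' lemma for rational systems of inequalities. -/
theorem exists_farkas (n : ℕ) : ∀ {ι : Type} [Fintype ι] (a : ι → Fin n → ℚ) (b : ι → ℚ),
    (¬ ∃ x : Fin n → ℚ, ∀ i, ∑ j, a i j * x j ≤ b i) →
    ∃ w : ι → ℚ, (∀ i, 0 ≤ w i) ∧ (∀ j, ∑ i, w i * a i j = 0) ∧ ∑ i, w i * b i < 0 := by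
  classical
  induction n with
  | zero =>
    intro ι _ a b h
    have : ∃ i, b i < 0 := by
      by_contra! h'
      exact h ⟨0, fun i => by simpa using h' i⟩
    obtain ⟨i, hi⟩ := this
    refine ⟨Pi.single i 1, fun k => ?_, fun j => j.elim0, ?_⟩
    · by_cases hk : k = i
      · subst hk; simp
      · simp [hk]
    · simpa [Pi.single_apply] using hi
  | succ n ih =>
    intro ι _ a b h
    -- Fourier–Motzkin elimination of coordinate 0: rows in `Z` are kept, and each row of `P` is
    -- combined with each row of `N` so that the coefficient cancels. `M` records the nonnegative
    -- multipliers.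
    let Z := {i // a i 0 = 0}
    let P := {i // 0 < a i 0}
    let N := {i // a i 0 < 0}
    let M : Z ⊕ (P × N) → ι → ℚ := fun s => match s with
      | .inl i => Pi.single i.1 1
      | .inr (p, q) => (-a q.1 0) • Pi.single p.1 1 + a p.1 0 • Pi.single q.1 1
    have hsum : ∀ (s : Z ⊕ (P × N)) (f : ι → ℚ), ∑ i, M s i * f i = match s with
      | .inl i => f i.1
      | .inr (p, q) => -a q.1 0 * f p.1 + a p.1 0 * f q.1 := by
      rintro (i | ⟨p, q⟩) f
      · simp [M, Pi.single_apply]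
      · simp [M, Pi.single_apply, add_mul, Finset.sum_add_distrib]
    have hM : ∀ s i, 0 ≤ M s i := by
      have hs : ∀ k i : ι, (0 : ℚ) ≤ (Pi.single k 1 : ι → ℚ) i := fun k i => by
        by_cases hk : i = k
        · subst hk; simp
        · simp [hk]
      rintro (k | ⟨p, q⟩) i
      · exact hs _ _
      · have h1 := p.2
        have h2 := q.2
        simp only [M, Pi.add_apply, Pi.smul_apply, smul_eq_mul]
        have := mul_nonneg (neg_nonneg.2 h2.le) (hs p.1 i)
        have := mul_nonneg h1.le (hs q.1 i)
        linarith
    have hM0 : ∀ s, ∑ i, M s i * a i 0 = 0 := by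
      rintro (k | ⟨p, q⟩)
      · exact (hsum (.inl k) fun i => a i 0).trans k.2
      · exact (hsum (.inr (p, q)) fun i => a i 0).trans (by ring)
    obtain ⟨w, hw, hwa, hwb⟩ := ih (fun s j => ∑ i, M s i * a i j.succ)
      (fun s => ∑ i, M s i * b i) (by
        rintro ⟨y, hy⟩
        apply h
        have hy' : ∀ s, ∑ i, M s i * (∑ j : Fin n, a i j.succ * y j) ≤ ∑ i, M s i * b i := by
          intro s
          refine le_trans (le_of_eq ?_) (hy s)
          simp only [Finset.mul_sum, Finset.sum_mul]
          rw [Finset.sum_comm]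
          simp only [mul_assoc]
        obtain ⟨t, ht1, ht2⟩ := exists_between_of_forall_le
          (fun q : N => (b q.1 - ∑ j : Fin n, a q.1 j.succ * y j) / a q.1 0)
          (fun p : P => (b p.1 - ∑ j : Fin n, a p.1 j.succ * y j) / a p.1 0) (by
            intro q p
            have h1 := p.2
            have h2 := q.2
            have := hy' (.inr (p, q))
            simp only [hsum] at this
            rw [div_le_iff_of_neg h2, div_mul_eq_mul_div, div_le_iff₀ h1]
            linarith)
        refine ⟨Fin.cons t y, fun i => ?_⟩
        rw [Fin.sum_univ_succ]
        simp only [Fin.cons_zero, Fin.cons_succ]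
        rcases lt_trichotomy (a i 0) 0 with hi | hi | hi
        · have := ht1 ⟨i, hi⟩
          rw [div_le_iff_of_neg hi] at this
          linarith
        · have := hy' (.inl ⟨i, hi⟩)
          simp only [hsum] at this
          rw [hi]; linarith
        · have := ht2 ⟨i, hi⟩
          rw [le_div_iff₀ hi] at this
          linarith)
    have key : ∀ f : ι → ℚ, ∑ i, (∑ s, w s * M s i) * f i = ∑ s, w s * ∑ i, M s i * f i := by
      intro f
      simp only [Finset.mul_sum, Finset.sum_mul]
      rw [Finset.sum_comm]
      simp only [mul_assoc]
    refine ⟨fun i => ∑ s, w s * M s i,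
      fun i => Finset.sum_nonneg fun s _ => mul_nonneg (hw s) (hM s i), fun j => ?_, ?_⟩
    · rw [key]
      refine Fin.cases ?_ (fun j => ?_) j
      · simp [hM0]
      · exact hwa j
    · rw [key]; exact hwb

/-! ### Sparse integral certificates -/

/-- Ratio test: `t` is the minimum of `w i / u i` over the positive `u i`. Moving from `w` along
`-u` up to that point loses a support element and leaves the orthant nowhere. -/
theorem exists_sub_smul_nonneg {ι : Type} [Fintype ι] {w u : ι → ℚ} (hw : ∀ i, 0 ≤ w i)
    (hu : ∀ i, w i = 0 → u i = 0) (hpos : ∃ i, 0 < u i) :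
    ∃ t, 0 < t ∧ (∀ i, 0 ≤ w i - t * u i) ∧ ∃ i, w i ≠ 0 ∧ w i - t * u i = 0 := by
  classical
  obtain ⟨i₀, hi₀⟩ := hpos
  obtain ⟨i, hi, hmin⟩ := Finset.exists_min_image (Finset.univ.filter fun i => 0 < u i)
    (fun i => w i / u i) ⟨i₀, by simpa using hi₀⟩
  replace hi : 0 < u i := by simpa using hi
  have hwi : w i ≠ 0 := fun h => hi.ne' (hu i h)
  refine ⟨w i / u i, div_pos (lt_of_le_of_ne (hw i) hwi.symm) hi, fun k => ?_, i, hwi, ?_⟩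
  · rcases le_or_gt (u k) 0 with hk | hk
    · have := mul_nonneg (div_nonneg (hw i) hi.le) (neg_nonneg.2 hk)
      linarith [hw k]
    · have := hmin k (by simpa using hk)
      rw [le_div_iff₀ hk] at this
      linarith
  · field_simp
    ring

/-- A Farkas certificate of minimal support spans the space of linear relations on its support. -/
theorem exists_minimal_farkas {n : ℕ} {ι : Type} [Fintype ι] (a : ι → Fin n → ℚ) (b : ι → ℚ)
    (h : ¬ ∃ x : Fin n → ℚ, ∀ i, ∑ j, a i j * x j ≤ b i) :
    ∃ w : ι → ℚ, (∀ i, 0 ≤ w i) ∧ (∀ j, ∑ i, w i * a i j = 0) ∧ ∑ i, w i * b i < 0 ∧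
      ∀ u : ι → ℚ, (∀ i, w i = 0 → u i = 0) → (∀ j, ∑ i, u i * a i j = 0) → (∃ i, 0 < u i) →
        ∃ t, 0 < t ∧ ∀ i, w i = t * u i := by
  classical
  let cert : (ι → ℚ) → Prop := fun w =>
    (∀ i, 0 ≤ w i) ∧ (∀ j, ∑ i, w i * a i j = 0) ∧ ∑ i, w i * b i < 0
  let supp : (ι → ℚ) → ℕ := fun w => (Finset.univ.filter fun i => w i ≠ 0).card
  have hex : ∃ k, ∃ w, cert w ∧ supp w = k := by
    obtain ⟨w, hw⟩ := exists_farkas n a b h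
    exact ⟨_, w, hw, rfl⟩
  obtain ⟨w, hw, hk⟩ := Nat.find_spec hex
  have hmin : ∀ v, cert v → (∀ i, w i = 0 → v i = 0) → (∃ i, w i ≠ 0 ∧ v i = 0) → False := by
    rintro v hv h1 ⟨i, hi, hi'⟩
    refine Nat.find_min hex (m := supp v) ?_ ⟨v, hv, rfl⟩
    rw [← hk]
    refine Finset.card_lt_card ⟨fun k => ?_, fun hsub => ?_⟩
    · simp only [Finset.mem_filter, Finset.mem_univ, true_and]
      exact fun hv hw => hv (h1 k hw)
    · have := hsub (show i ∈ _ by simpa using hi)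
      simp [hi'] at this
  have hlin : ∀ (u v : ι → ℚ) (t : ℚ) (f : ι → ℚ),
      ∑ i, (u i - t * v i) * f i = ∑ i, u i * f i - t * ∑ i, v i * f i := by
    intro u v t f
    rw [Finset.mul_sum, ← Finset.sum_sub_distrib]
    exact Finset.sum_congr rfl fun i _ => by ring
  obtain ⟨hw0, hwa, hwb⟩ := hw
  refine ⟨w, hw0, hwa, hwb, fun u hu hua hpos => ?_⟩
  obtain ⟨t, ht, hv0, i, hi, hvi⟩ := exists_sub_smul_nonneg hw0 hu hpos
  refine ⟨t, ht, ?_⟩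
  set v : ι → ℚ := fun i => w i - t * u i with hv
  have hva : ∀ j, ∑ i, v i * a i j = 0 := fun j => by rw [hv, hlin, hwa, hua]; simp
  have hvs : ∀ i, w i = 0 → v i = 0 := fun i hi => by simp [hv, hi, hu i hi]
  -- `v` is a nonnegative relation of smaller support, so only the sign of its value can prevent it
  -- from being a certificate.
  have hvb : 0 ≤ ∑ i, v i * b i := by
    by_contra! hneg
    exact hmin v ⟨hv0, hva, hneg⟩ hvs ⟨i, hi, hvi⟩
  by_contra! hne
  obtain ⟨k, hk⟩ := hne
  have hvk : 0 < v k := lt_of_le_of_ne (hv0 k) (fun h0 => hk (by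
    have : w k - t * u k = 0 := h0.symm
    linarith))
  -- If `v ≠ 0`, then `w - s v` has smaller support too, and its value is still negative because
  -- that of `v` is nonnegative: a contradiction to minimality.
  obtain ⟨s, hs, hz0, l, hl, hzl⟩ := exists_sub_smul_nonneg hw0 hvs ⟨k, hvk⟩
  refine hmin (fun i => w i - s * v i) ⟨hz0, fun j => by rw [hlin, hwa, hva]; simp, ?_⟩
    (fun i hi => by simp [hi, hvs i hi]) ⟨l, hl, hzl⟩
  rw [hlin]
  have := mul_nonneg hs.le hvb
  linarith

open Matrix

attribute [local instance] Matrix.normedAddCommGroup in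
/-- A bounded integral linear relation among integral vectors that satisfy some rational one. -/
theorem exists_int_relation {n : ℕ} {σ : Type} [Fintype σ] [Nonempty σ] (a : σ → Fin n → ℤ)
    (H : ℕ) (hH1 : 1 ≤ H) (hH : ∀ i j, |a i j| ≤ H) (w : σ → ℚ) (hw : w ≠ 0)
    (hwa : ∀ j, ∑ i, w i * a i j = 0) :
    ∃ t : σ → ℤ, t ≠ 0 ∧ (∀ j, ∑ i, t i * a i j = 0) ∧
      ∀ i, |t i| ≤ ((Fintype.card σ * H) ^ n : ℕ) := by
  classical
  let v : Fin n → σ → ℚ := fun j i => a i j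
  -- Siegel's lemma needs fewer equations than unknowns, so only a maximal independent set of
  -- equations is kept. The nonzero solution `w` makes it smaller than `σ`.
  obtain ⟨κ, e, he, hspan, hli⟩ := exists_linearIndependent' ℚ v
  have : Fintype κ := Fintype.ofInjective e he
  have hext : ∀ t : σ → ℤ, (∀ k, ∑ i, t i * a i (e k) = 0) → ∀ j, ∑ i, t i * a i j = 0 := by
    intro t ht j
    let φ : (σ → ℚ) →ₗ[ℚ] ℚ := ∑ i, (t i : ℚ) • LinearMap.proj i
    have hφ : ∀ j, φ (v j) = ((∑ i, t i * a i j : ℤ) : ℚ) := fun j => by simp [φ, v]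
    have hle : Submodule.span ℚ (Set.range v) ≤ LinearMap.ker φ := by
      rw [← hspan, Submodule.span_le]
      rintro _ ⟨k, rfl⟩
      have := hφ (e k)
      rw [ht k] at this
      simpa using this
    have := hle (Submodule.subset_span ⟨j, rfl⟩)
    rw [LinearMap.mem_ker, hφ] at this
    exact_mod_cast this
  have hcardle : Fintype.card κ ≤ Fintype.card σ := by
    simpa using hli.fintype_card_le_finrank
  have hcard : Fintype.card κ < Fintype.card σ := by
    refine lt_of_le_of_ne hcardle fun heq => hw ?_
    have htop : Submodule.span ℚ (Set.range (v ∘ e)) = ⊤ :=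
      hli.span_eq_top_of_card_eq_finrank' (by simpa using heq)
    let ψ : (σ → ℚ) →ₗ[ℚ] ℚ := ∑ i, w i • LinearMap.proj i
    have hle : Submodule.span ℚ (Set.range (v ∘ e)) ≤ LinearMap.ker ψ := by
      rw [Submodule.span_le]
      rintro _ ⟨k, rfl⟩
      simpa [ψ, v] using hwa (e k)
    funext i
    have : Pi.single i 1 ∈ LinearMap.ker ψ := hle (htop ▸ Submodule.mem_top)
    simpa [ψ, Pi.single_apply] using this
  have hcardn : Fintype.card κ ≤ n := by simpa using Fintype.card_le_of_injective e he
  have hσ : 1 ≤ Fintype.card σ := Fintype.card_pos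
  rcases Nat.eq_zero_or_pos (Fintype.card κ) with h0 | h0
  · have : IsEmpty κ := Fintype.card_eq_zero_iff.1 h0
    obtain ⟨i₀⟩ := ‹Nonempty σ›
    refine ⟨Pi.single i₀ 1, by simp, hext _ fun k => isEmptyElim k, fun i => ?_⟩
    have h1 : (1 : ℤ) ≤ ((Fintype.card σ * H) ^ n : ℕ) :=
      mod_cast Nat.one_le_pow _ _ (Nat.mul_pos hσ hH1)
    by_cases hi : i = i₀
    · subst hi; simpa using h1
    · simpa [hi] using h1.trans' zero_le_one
  · obtain ⟨t, ht0, htA, htn⟩ := Int.Matrix.exists_ne_zero_int_vec_norm_le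
      (Matrix.of fun (k : κ) (i : σ) => a i (e k)) hcard h0
    refine ⟨t, ht0, hext t fun k => ?_, fun i => ?_⟩
    · have := congrFun htA k
      simp only [Matrix.mulVec, dotProduct, Matrix.of_apply, Pi.zero_apply] at this
      rw [← this]
      exact Finset.sum_congr rfl fun i _ => mul_comm _ _
    · have hA : ‖(Matrix.of fun (k : κ) (i : σ) => a i (e k))‖ ≤ H := by
        rw [Matrix.norm_le_iff (by positivity)]
        intro k i
        rw [Matrix.of_apply, Int.norm_eq_abs]
        exact_mod_cast hH i (e k)
      have hbase : (1 : ℝ) ≤ Fintype.card σ * H := by exact_mod_cast Nat.mul_pos hσ hH1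
      have hH1' : (1 : ℝ) ≤ H := by exact_mod_cast hH1
      -- The exponent `card κ / (card σ - card κ)` in Siegel's bound is hence at most `card κ ≤ n`.
      have hgap : (1 : ℝ) ≤ (Fintype.card σ : ℝ) - Fintype.card κ := by
        have : (Fintype.card κ : ℝ) + 1 ≤ Fintype.card σ := by exact_mod_cast hcard
        linarith
      have h2 : ‖t‖ ≤ (Fintype.card σ * H : ℝ) ^ (n : ℝ) := by
        refine htn.trans ?_
        refine (Real.rpow_le_rpow (by positivity) (mul_le_mul_of_nonneg_left
          (max_le hH1' hA) (by positivity)) (by positivity)).trans ?_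
        refine Real.rpow_le_rpow_of_exponent_le hbase ?_
        refine (div_le_self (by positivity) hgap).trans ?_
        exact_mod_cast hcardn
      have h3 := (norm_le_pi_norm t i).trans h2
      rw [Real.rpow_natCast, Int.norm_eq_abs] at h3
      exact_mod_cast h3

/-- Infeasible systems with integral left-hand sides have sparse integral Farkas certificates whose
size does not depend on the right-hand sides. -/
theorem exists_sparse_farkas {n : ℕ} {ι : Type} [Fintype ι] (a : ι → Fin n → ℤ) (b : ι → ℚ)
    (H : ℕ) (hH1 : 1 ≤ H) (hH : ∀ i j, |a i j| ≤ H)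
    (h : ¬ ∃ x : Fin n → ℚ, ∀ i, ∑ j, (a i j : ℚ) * x j ≤ b i) :
    ∃ w : ι → ℤ, (∀ i, 0 ≤ w i) ∧ (∀ j, ∑ i, w i * a i j = 0) ∧ ∑ i, (w i : ℚ) * b i < 0 ∧
      (Finset.univ.filter fun i => w i ≠ 0).card ≤ n + 1 ∧
      ∀ i, w i ≤ (((n + 1) * H) ^ n : ℕ) := by
  classical
  obtain ⟨w, hw0, hwa, hwb, hmin⟩ := exists_minimal_farkas (fun i j => (a i j : ℚ)) b h
  set S : Finset ι := Finset.univ.filter fun i => w i ≠ 0 with hS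
  have hmem : ∀ i, i ∈ S ↔ w i ≠ 0 := fun i => by simp [hS]
  have hSne : S.Nonempty := by
    by_contra hne
    have : ∀ i, w i = 0 := fun i => by
      by_contra hi
      exact hne ⟨i, (hmem i).2 hi⟩
    simp [this] at hwb
  have hprop : ∀ u : ι → ℚ, (∀ i, w i = 0 → u i = 0) → (∀ j, ∑ i, u i * a i j = 0) →
      (∃ i, u i ≠ 0) → ∃ t, t ≠ 0 ∧ ∀ i, w i = t * u i := by
    rintro u hu hua ⟨i, hi⟩
    rcases lt_or_gt_of_ne hi with hi | hi
    · obtain ⟨t, ht, h⟩ := hmin (fun i => -u i) (fun i hi => by simp [hu i hi])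
        (fun j => by simp [hua j]) ⟨i, by simpa using hi⟩
      exact ⟨-t, by simpa using ht.ne', fun i => by rw [h]; ring⟩
    · obtain ⟨t, ht, h⟩ := hmin u hu hua ⟨i, hi⟩
      exact ⟨t, ht.ne', h⟩
  have hScard : S.card ≤ n + 1 := by
    by_contra! hlt
    -- More than `n` rows remain without `i₀`, so they are dependent; a relation vanishing at `i₀`
    -- cannot be proportional to `w`.
    obtain ⟨i₀, hi₀⟩ := hSne
    have hdep : ¬ LinearIndependent ℚ (fun (i : S.erase i₀) (j : Fin n) => (a i j : ℚ)) := by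
      intro hli
      have := hli.fintype_card_le_finrank
      rw [Fintype.card_coe, Finset.card_erase_of_mem hi₀, Module.finrank_fin_fun] at this
      omega
    rw [Fintype.not_linearIndependent_iff] at hdep
    obtain ⟨g, hg, k, hk⟩ := hdep
    let u : ι → ℚ := fun i => if hi : i ∈ S.erase i₀ then g ⟨i, hi⟩ else 0
    have hu : ∀ i : S.erase i₀, u i = g i := fun i => by simp only [u, dif_pos i.2]
    have hu' : ∀ i, i ∉ S.erase i₀ → u i = 0 := fun i hi => by simp only [u, dif_neg hi]
    obtain ⟨t, ht, h⟩ := hprop u (fun i hi => hu' i fun hi' =>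
      (hmem i).1 (Finset.mem_of_mem_erase hi') hi) (fun j => by
        have := congrFun hg j
        rw [Finset.sum_apply] at this
        simp only [Pi.smul_apply, smul_eq_mul, Pi.zero_apply] at this
        rw [← this, ← Finset.sum_subset (Finset.subset_univ (S.erase i₀))
          (fun i _ hi => by rw [hu' i hi, zero_mul]), ← Finset.sum_coe_sort]
        exact Finset.sum_congr rfl fun i _ => by rw [hu]) ⟨k, by rwa [hu]⟩
    exact (hmem i₀).1 hi₀ (by rw [h, hu' i₀ (Finset.notMem_erase i₀ S), mul_zero])
  have : Nonempty S := hSne.to_subtype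
  have hsumS : ∀ f : ι → ℚ, (∀ i, i ∉ S → f i = 0) → ∑ i : S, f i = ∑ i, f i := fun f hf => by
    rw [Finset.sum_coe_sort S f]
    exact Finset.sum_subset (Finset.subset_univ S) fun i _ hi => hf i hi
  obtain ⟨t, ht0, hta, htb⟩ := exists_int_relation (fun (i : S) => a i) H hH1 (fun i => hH i)
    (fun i => w i) (fun h0 => by
      obtain ⟨i, hi⟩ := hSne
      exact (hmem i).1 hi (congrFun h0 ⟨i, hi⟩)) (fun j => by
      rw [hsumS (fun i => w i * a i j), hwa]
      intro i hi
      rw [not_not.1 (mt (hmem i).2 hi), zero_mul])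
  let u : ι → ℤ := fun i => if hi : i ∈ S then t ⟨i, hi⟩ else 0
  have hu : ∀ i : S, u i = t i := fun i => by simp only [u, dif_pos i.2]
  have hu' : ∀ i, i ∉ S → u i = 0 := fun i hi => by simp only [u, dif_neg hi]
  have hua : ∀ j, ∑ i, u i * a i j = 0 := fun j => by
    rw [← hta j, ← Finset.sum_subset (Finset.subset_univ S)
          (fun i _ hi => by rw [hu' i hi, zero_mul]), ← Finset.sum_coe_sort]
    exact Finset.sum_congr rfl fun i _ => by rw [hu]
  obtain ⟨s, hs, hws⟩ := hprop (fun i => u i)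
    (fun i hi => by rw [hu' i fun hi' => (hmem i).1 hi' hi, Int.cast_zero])
    (fun j => by exact_mod_cast hua j) (by
      obtain ⟨i, hi⟩ := Function.ne_iff.1 ht0
      exact ⟨i, by rw [hu]; exact_mod_cast hi⟩)
  have habs : ∀ i, w i = |s| * |(u i : ℚ)| := fun i => by
    rw [← abs_mul, ← hws, abs_of_nonneg (hw0 i)]
  have hspos : 0 < |s| := abs_pos.2 hs
  -- Being proportional to `w ≥ 0`, the Siegel solution has a constant sign, and its absolute value
  -- is again a relation.
  obtain ⟨ε, hε⟩ : ∃ ε : ℤ, ∀ i, |u i| = ε * u i := by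
    rcases lt_or_gt_of_ne hs with hs | hs
    · refine ⟨-1, fun i => ?_⟩
      have h1 := hw0 i
      rw [hws] at h1
      have : (u i : ℚ) ≤ 0 := nonpos_of_mul_nonneg_right h1 hs
      rw [abs_of_nonpos (by exact_mod_cast this)]
      ring
    · refine ⟨1, fun i => ?_⟩
      have h1 := hw0 i
      rw [hws] at h1
      have : (0 : ℚ) ≤ u i := nonneg_of_mul_nonneg_right h1 hs
      rw [abs_of_nonneg (by exact_mod_cast this)]
      ring
  refine ⟨fun i => |u i|, fun i => abs_nonneg _, fun j => ?_, ?_, ?_, fun i => ?_⟩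
  · simp only [hε, mul_assoc]
    rw [← Finset.mul_sum, hua, mul_zero]
  · have : ∑ i, w i * b i = |s| * ∑ i, ((|u i| : ℤ) : ℚ) * b i := by
      rw [Finset.mul_sum]
      refine Finset.sum_congr rfl fun i _ => ?_
      rw [habs, Int.cast_abs, mul_assoc]
    rw [this] at hwb
    exact (pos_iff_neg_of_mul_neg hwb).1 hspos
  · refine le_trans (Finset.card_le_card fun i hi => ?_) hScard
    by_contra hiS
    simp [hu' i hiS] at hi
  · show |u i| ≤ _
    by_cases hi : i ∈ S
    · rw [hu ⟨i, hi⟩]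
      refine (htb ⟨i, hi⟩).trans ?_
      rw [Fintype.card_coe]
      exact_mod_cast Nat.pow_le_pow_left (Nat.mul_le_mul_right _ hScard) _
    · rw [hu' i hi, abs_zero]
      positivity

/-! ### Simultaneous Diophantine approximation -/

/-- Dirichlet's pigeonhole argument: among `Q ^ N + 1` multiples of `u`, with `N` the dimension, two
have fractional parts in the same cell of side `1 / Q`. -/
theorem exists_simultaneous_approx {ι : Type} [Fintype ι] (u : ι → ℝ) (Q : ℕ) (hQ : 0 < Q) :
    ∃ q : ℕ, 1 ≤ q ∧ q ≤ Q ^ Fintype.card ι ∧ ∃ p : ι → ℤ, ∀ i, |q * u i - p i| < 1 / Q := by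
  classical
  have hQ' : (0 : ℝ) < Q := by exact_mod_cast hQ
  let F : Fin (Q ^ Fintype.card ι + 1) → ι → Fin Q := fun k i =>
    ⟨⌊(Q : ℝ) * Int.fract ((k : ℕ) * u i)⌋₊, by
      rw [Nat.floor_lt (mul_nonneg hQ'.le (Int.fract_nonneg _))]
      have := mul_lt_mul_of_pos_left (Int.fract_lt_one ((k : ℕ) * u i)) hQ'
      simpa using this⟩
  obtain ⟨k, l, hkl, hF⟩ := Fintype.exists_ne_map_eq_of_card_lt F (by simp)
  wlog hlt : k < l generalizing k l
  · exact this l k hkl.symm hF.symm (lt_of_le_of_ne (not_lt.1 hlt) hkl.symm)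
  have hlt' : (k : ℕ) < l := hlt
  refine ⟨l - k, by omega, by have := l.2; omega,
    fun i => ⌊((l : ℕ) : ℝ) * u i⌋ - ⌊((k : ℕ) : ℝ) * u i⌋, fun i => ?_⟩
  have h1 : ⌊(Q : ℝ) * Int.fract ((k : ℕ) * u i)⌋₊ = ⌊(Q : ℝ) * Int.fract ((l : ℕ) * u i)⌋₊ :=
    congrArg Fin.val (congrFun hF i)
  have hk0 := mul_nonneg hQ'.le (Int.fract_nonneg (((k : ℕ) : ℝ) * u i))
  have hl0 := mul_nonneg hQ'.le (Int.fract_nonneg (((l : ℕ) : ℝ) * u i))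
  have hk1 := Nat.floor_le hk0
  have hk2 := Nat.lt_floor_add_one ((Q : ℝ) * Int.fract ((k : ℕ) * u i))
  have hl1 := Nat.floor_le hl0
  have hl2 := Nat.lt_floor_add_one ((Q : ℝ) * Int.fract ((l : ℕ) * u i))
  rw [h1] at hk1 hk2
  have heq : ((l - k : ℕ) : ℝ) * u i -
      ((⌊((l : ℕ) : ℝ) * u i⌋ - ⌊((k : ℕ) : ℝ) * u i⌋ : ℤ) : ℝ) =
      Int.fract ((l : ℕ) * u i) - Int.fract ((k : ℕ) * u i) := by
    rw [Nat.cast_sub hlt'.le, Int.fract, Int.fract]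
    push_cast
    ring
  rw [heq, abs_lt, ← neg_div, div_lt_iff₀ hQ', lt_div_iff₀ hQ']
  constructor <;> nlinarith

/-- Dirichlet's theorem is applied to `u / μ` with `μ` the largest absolute value, and `γ = μ / q`.
A coordinate attaining the maximum becomes `±1`, so an error below 1 means that it is approximated
exactly and vanishes from the remainder. Zero coordinates stay zero for the same reason, so the
support shrinks. -/
theorem exists_approx_step {ι : Type} [Fintype ι] [DecidableEq ι] (u : ι → ℝ) (Q : ℕ) (hQ : 2 ≤ Q)
    (hu : ∃ i, (Q : ℝ) ^ (Fintype.card ι + 1) < |u i|) :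
    ∃ (γ : ℝ) (p : ι → ℤ), Q ≤ γ ∧ (∀ i, |u i - γ * p i| ≤ γ / Q) ∧
      (∀ i, |p i| ≤ (Q : ℤ) ^ Fintype.card ι) ∧
      (Finset.univ.filter fun i => u i - γ * p i ≠ 0).card <
        (Finset.univ.filter fun i => u i ≠ 0).card := by
  have hQ' : (2 : ℝ) ≤ Q := by exact_mod_cast hQ
  have hQ0 : (0 : ℝ) < Q := by linarith
  have hQ1 : 1 / (Q : ℝ) < 1 := by rw [div_lt_one hQ0]; linarith
  obtain ⟨i₁, hi₁⟩ := hu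
  have : Nonempty ι := ⟨i₁⟩
  obtain ⟨i₀, hi₀⟩ := Finite.exists_max fun i => |u i|
  set μ := |u i₀| with hμ
  have hμQ : (Q : ℝ) ^ (Fintype.card ι + 1) < μ := hi₁.trans_le (hi₀ i₁)
  have hμ0 : 0 < μ := lt_trans (by positivity) hμQ
  obtain ⟨q, hq1, hqQ, p, hp⟩ := exists_simultaneous_approx (fun i => u i / μ) Q (by omega)
  have hq0 : (0 : ℝ) < q := by exact_mod_cast hq1
  have hqQ' : (q : ℝ) ≤ (Q : ℝ) ^ Fintype.card ι := by exact_mod_cast hqQ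
  have hunit : ∀ i, |u i / μ| ≤ 1 := fun i => by
    rw [abs_div, abs_of_pos hμ0, div_le_one hμ0]
    exact hi₀ i
  have hdiff : ∀ i, u i - μ / q * p i = μ / q * (q * (u i / μ) - p i) := fun i => by
    field_simp
  have hpz : ∀ i, u i = 0 → p i = 0 := fun i hi => by
    have h := (hp i).trans hQ1
    simp only [hi, zero_div, mul_zero, zero_sub, abs_neg] at h
    rw [← Int.abs_lt_one_iff]
    exact_mod_cast h
  have hz0 : u i₀ - μ / q * p i₀ = 0 := by
    obtain ⟨σ, hσ⟩ : ∃ σ : ℤ, u i₀ / μ = σ := by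
      rcases abs_choice (u i₀) with h | h
      · exact ⟨1, by rw [hμ, h, div_self (by rw [← h]; exact hμ0.ne')]; simp⟩
      · refine ⟨-1, ?_⟩
        have : u i₀ = -μ := by rw [hμ, h]; ring
        rw [this, neg_div, div_self hμ0.ne']; simp
    have h := (hp i₀).trans hQ1
    simp only [hσ] at h
    have h' : |(q : ℤ) * σ - p i₀| < 1 := by exact_mod_cast h
    rw [Int.abs_lt_one_iff, sub_eq_zero] at h'
    rw [hdiff, hσ, ← h']
    push_cast
    ring
  refine ⟨μ / q, p, ?_, fun i => ?_, fun i => ?_, ?_⟩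
  · rw [le_div_iff₀ hq0]
    rw [pow_succ'] at hμQ
    exact (mul_le_mul_of_nonneg_left hqQ' hQ0.le).trans hμQ.le
  · rw [hdiff, abs_mul, abs_of_pos (div_pos hμ0 hq0), div_eq_mul_one_div _ (Q : ℝ)]
    exact mul_le_mul_of_nonneg_left (hp i).le (div_pos hμ0 hq0).le
  · have h1 : |(p i : ℝ)| < q + 1 := by
      have h2 : |q * (u i / μ)| ≤ q := by
        rw [abs_mul, abs_of_pos hq0]
        exact mul_le_of_le_one_right hq0.le (hunit i)
      have h3 := (hp i).trans hQ1
      rw [abs_lt] at h3 ⊢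
      rw [abs_le] at h2
      constructor <;> linarith [h3.1, h3.2, h2.1, h2.2]
    have h2 : |p i| < q + 1 := by exact_mod_cast h1
    have h3 : (q : ℤ) ≤ (Q : ℤ) ^ Fintype.card ι := by exact_mod_cast hqQ
    omega
  · refine Finset.card_lt_card ⟨fun i => ?_, fun hsub => ?_⟩
    · simp only [Finset.mem_filter, Finset.mem_univ, true_and]
      exact fun h hi => h (by rw [hi, hpz i hi]; simp)
    · have hne : u i₀ ≠ 0 := abs_pos.1 hμ0
      have := hsub (show i₀ ∈ _ by simpa using hne)
      simp [hz0] at this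

/-! ### Substitution of an integral functional by a bounded one -/

/-- The real vector of an integral vector. -/
def realVec {ι : Type} (p : ι → ℤ) : ι → ℝ := fun i => p i

/-- On `Y`, the function `f` is nonpositive, or its sign is controlled by a bounded integral vector
outside `V`. -/
def Reducible {ι : Type} [Fintype ι] (δ : ℝ) (B : ℤ) (V : Submodule ℝ (ι → ℝ)) (Y : Set (ι → ℝ))
    (f : (ι → ℝ) → ℝ) : Prop :=
  (∀ y ∈ Y, f y ≤ 0) ∨ ∃ γ : ℝ, 0 < γ ∧ ∃ p : ι → ℤ, (∀ i, |p i| ≤ B) ∧ realVec p ∉ V ∧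
    ∀ y ∈ Y, realVec p ⬝ᵥ y ≤ δ ∧ f y ≤ γ * (realVec p ⬝ᵥ y + δ)

theorem Reducible.mono {ι : Type} [Fintype ι] {δ : ℝ} {B : ℤ} {V : Submodule ℝ (ι → ℝ)}
    {Y Y' : Set (ι → ℝ)} {f f' : (ι → ℝ) → ℝ} (h : Reducible δ B V Y f) (hY : Y' ⊆ Y)
    (hf : ∀ y ∈ Y', f' y = f y) : Reducible δ B V Y' f' := by
  rcases h with h | ⟨γ, hγ, p, hp, hpV, h⟩
  · exact Or.inl fun y hy => (hf y hy).trans_le (h y (hY hy))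
  · exact Or.inr ⟨γ, hγ, p, hp, hpV, fun y hy =>
      ⟨(h y (hY hy)).1, (hf y hy).trans_le (h y (hY hy)).2⟩⟩

/-- The points of the box of radius `R` that are orthogonal to `V`. -/
def boxPerp {ι : Type} [Fintype ι] (R : ℝ) (V : Submodule ℝ (ι → ℝ)) : Set (ι → ℝ) :=
  {y | (∀ i, |y i| ≤ R) ∧ ∀ v ∈ V, v ⬝ᵥ y = 0}

theorem abs_dotProduct_le {ι : Type} [Fintype ι] {v y : ι → ℝ} {A R : ℝ} (hA : 0 ≤ A)
    (hv : ∀ i, |v i| ≤ A) (hy : ∀ i, |y i| ≤ R) : |v ⬝ᵥ y| ≤ Fintype.card ι * (A * R) := by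
  refine (Finset.abs_sum_le_sum_abs _ _).trans ?_
  refine (Finset.sum_le_card_nsmul _ _ (A * R) fun i _ => ?_).trans (by simp)
  rw [abs_mul]
  exact mul_le_mul (hv i) (hy i) (abs_nonneg _) hA

/-- Induction on the support of `u`. In `z = u + r`, `u` is the part still to be approximated, and
`r` collects the fractional multiples of the directions already removed. The condition `r ∈ V`
reflects that all those directions lay in `V`, so `r` is invisible on `boxPerp R V`. Each round adds
at most `Q ^ N` to the entries of `r`, with `N` the dimension; the budget pays for the `s` rounds
left. -/
theorem exists_substitution_aux {ι : Type} [Fintype ι] (Q R : ℕ) (hQ : 2 ≤ Q) (hR : 1 ≤ R) (s : ℕ) :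
    ∀ (z : ι → ℤ) (u r : ι → ℝ), (∀ i, (z i : ℝ) = u i + r i) →
      (Finset.univ.filter fun i => u i ≠ 0).card ≤ s →
      (∀ i, |r i| + s * (Q : ℝ) ^ Fintype.card ι ≤
        Fintype.card ι * (Q : ℝ) ^ Fintype.card ι) →
      ∃ p' : ι → ℤ, (∀ i, |p' i| ≤ ((Fintype.card ι * R * Q ^ (Fintype.card ι + 1) + 1) ^ s *
          (Q ^ (Fintype.card ι + 1) + Fintype.card ι * Q ^ Fintype.card ι) : ℕ)) ∧
        ∀ V : Submodule ℝ (ι → ℝ), r ∈ V →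
          Reducible ((Fintype.card ι * R + 1) / Q) (Q ^ Fintype.card ι) V
            {y | y ∈ boxPerp R V ∧ realVec p' ⬝ᵥ y ≤ 0} (fun y => realVec z ⬝ᵥ y) ∧
          Reducible ((Fintype.card ι * R + 1) / Q) (Q ^ Fintype.card ι) V
            {y | y ∈ boxPerp R V ∧ 1 ≤ realVec p' ⬝ᵥ y} (fun y => 1 - realVec z ⬝ᵥ y) := by
  classical
  have hQ0 : (0 : ℝ) < Q := by exact_mod_cast (by omega : 0 < Q)
  set N := Fintype.card ι with hN
  have base : ∀ (s : ℕ) (z : ι → ℤ) (u r : ι → ℝ), (∀ i, (z i : ℝ) = u i + r i) →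
      (∀ i, |u i| ≤ (Q : ℝ) ^ (N + 1)) →
      (∀ i, |r i| + s * (Q : ℝ) ^ N ≤ N * (Q : ℝ) ^ N) →
      ∃ p' : ι → ℤ, (∀ i, |p' i| ≤ ((N * R * Q ^ (N + 1) + 1) ^ s *
          (Q ^ (N + 1) + N * Q ^ N) : ℕ)) ∧
        ∀ V : Submodule ℝ (ι → ℝ), r ∈ V →
          Reducible ((N * R + 1) / Q) (Q ^ N) V
            {y | y ∈ boxPerp R V ∧ realVec p' ⬝ᵥ y ≤ 0} (fun y => realVec z ⬝ᵥ y) ∧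
          Reducible ((N * R + 1) / Q) (Q ^ N) V
            {y | y ∈ boxPerp R V ∧ 1 ≤ realVec p' ⬝ᵥ y} (fun y => 1 - realVec z ⬝ᵥ y) := by
    intro s z u r hz hu hr
    refine ⟨z, fun i => ?_, fun V _ => ⟨Or.inl fun y hy => hy.2, Or.inl fun y hy => ?_⟩⟩
    · have h1 : |(z i : ℝ)| ≤ (Q : ℝ) ^ (N + 1) + N * (Q : ℝ) ^ N := by
        rw [hz]
        refine (abs_add_le _ _).trans (add_le_add (hu i) ?_)
        have := hr i
        have : 0 ≤ (s : ℝ) * (Q : ℝ) ^ N := by positivity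
        linarith
      have h2 : |z i| ≤ ((Q ^ (N + 1) + N * Q ^ N : ℕ) : ℤ) := by
        rw [← Int.cast_le (R := ℝ)]
        push_cast
        exact h1
      refine h2.trans ?_
      exact_mod_cast Nat.le_mul_of_pos_left _ (by positivity)
    · simpa using hy.2
  induction s with
  | zero =>
    intro z u r hz hu hr
    refine base 0 z u r hz (fun i => ?_) hr
    have : u i = 0 := by
      by_contra hi
      have := Finset.card_pos.2 ⟨i, show i ∈ Finset.univ.filter fun i => u i ≠ 0 by simpa using hi⟩
      omega
    rw [this, abs_zero]
    positivity
  | succ s ih =>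
    intro z u r hz hu hr
    by_cases hbig : ∃ i, (Q : ℝ) ^ (N + 1) < |u i|
    swap
    · push Not at hbig
      exact base _ z u r hz hbig hr
    obtain ⟨γ, p, hγ, hup, hpQ, hcard⟩ := exists_approx_step u Q hQ hbig
    have hγ0 : 0 < γ := hQ0.trans_le hγ
    have hpR : ∀ i, |realVec p i| ≤ (Q : ℝ) ^ N := fun i => by
      have := hpQ i
      rw [realVec]
      exact_mod_cast this
    -- Subtracting `⌊γ⌋ p` rather than `γ p` keeps the remainder of `z` integral; the difference
    -- goes into `r`.
    obtain ⟨p'', hp'', hV⟩ := ih (fun i => z i - ⌊γ⌋ * p i) (fun i => u i - γ * p i)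
      (fun i => r i + Int.fract γ * p i) (fun i => by
        push_cast
        rw [hz, Int.fract]
        ring) (by omega) (fun i => by
        have h1 := hr i
        have h2 : |r i + Int.fract γ * p i| ≤ |r i| + (Q : ℝ) ^ N := by
          refine (abs_add_le _ _).trans (add_le_add le_rfl ?_)
          rw [abs_mul, abs_of_nonneg (Int.fract_nonneg γ)]
          exact (mul_le_of_le_one_left (abs_nonneg _) (Int.fract_lt_one γ).le).trans (hpR i)
        push_cast at h1
        linarith)
    set A : ℕ := (N * R * Q ^ (N + 1) + 1) ^ s * (Q ^ (N + 1) + N * Q ^ N) with hA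
    have hN0 : 0 < N := by
      obtain ⟨i, -⟩ := hbig
      exact Fintype.card_pos_iff.2 ⟨i⟩
    have hA0 : 0 < A := by positivity
    -- With this weight `|p''·y| ≤ W / Q` on the box, so the sign of `W p + p''` controls `p·y` up
    -- to `1 / Q`.
    set W : ℕ := N * R * Q * A with hW
    have hW0 : (0 : ℝ) < W := by exact_mod_cast (by positivity : 0 < W)
    refine ⟨fun i => W * p i + p'' i, fun i => ?_, fun V hrV => ?_⟩
    · refine (abs_add_le _ _).trans ?_
      rw [abs_mul, Nat.abs_cast]
      refine (add_le_add (mul_le_mul_of_nonneg_left (hpQ i) (by positivity)) (hp'' i)).trans ?_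
      rw [hW, hA]
      push_cast
      exact le_of_eq (by ring)
    have hdot : ∀ y, realVec (fun i => W * p i + p'' i) ⬝ᵥ y =
        W * (realVec p ⬝ᵥ y) + realVec p'' ⬝ᵥ y := fun y => by
      simp only [dotProduct, realVec, Finset.mul_sum, ← Finset.sum_add_distrib]
      exact Finset.sum_congr rfl fun i _ => by push_cast; ring
    have hzdot : ∀ y, realVec (fun i => z i - ⌊γ⌋ * p i) ⬝ᵥ y =
        realVec z ⬝ᵥ y - ⌊γ⌋ * (realVec p ⬝ᵥ y) := fun y => by
      simp only [dotProduct, realVec, Finset.mul_sum, ← Finset.sum_sub_distrib]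
      exact Finset.sum_congr rfl fun i _ => by push_cast; ring
    -- If `p ∈ V`, then `p·y = 0` and both `z` and the substitute reduce to their remainders.
    -- Otherwise `p` (negated for the right branch) is the controlling vector.
    by_cases hpV : realVec p ∈ V
    · obtain ⟨h1, h2⟩ := hV V (by
        have : (fun i => r i + Int.fract γ * (p i : ℝ)) = r + Int.fract γ • realVec p := by
          funext i; simp [realVec]
        rw [this]
        exact V.add_mem hrV (V.smul_mem _ hpV))
      refine ⟨h1.mono (fun y hy => ⟨hy.1, ?_⟩) (fun y hy => ?_),
        h2.mono (fun y hy => ⟨hy.1, ?_⟩) (fun y hy => ?_)⟩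
      · have := hy.2
        rwa [hdot, hy.1.2 _ hpV, mul_zero, zero_add] at this
      · rw [hzdot, hy.1.2 _ hpV, mul_zero, sub_zero]
      · have := hy.2
        rwa [hdot, hy.1.2 _ hpV, mul_zero, zero_add] at this
      · rw [hzdot, hy.1.2 _ hpV, mul_zero, sub_zero]
    · have hp''R : ∀ y ∈ boxPerp (R : ℝ) V, |realVec p'' ⬝ᵥ y| ≤ W / Q := fun y hy => by
        refine (abs_dotProduct_le (A := A) (by positivity) (fun i => ?_) hy.1).trans ?_
        · have := hp'' i
          rw [realVec]
          exact_mod_cast this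
        · rw [le_div_iff₀ hQ0, hW]
          push_cast
          exact le_of_eq (by ring)
      have hzu : ∀ y ∈ boxPerp (R : ℝ) V,
          |realVec z ⬝ᵥ y - γ * (realVec p ⬝ᵥ y)| ≤ γ * (N * R / Q) := fun y hy => by
        have h1 : realVec z ⬝ᵥ y - γ * (realVec p ⬝ᵥ y) =
            (fun i => u i - γ * p i) ⬝ᵥ y + r ⬝ᵥ y := by
          simp only [dotProduct, realVec, Finset.mul_sum, ← Finset.sum_sub_distrib,
            ← Finset.sum_add_distrib]
          exact Finset.sum_congr rfl fun i _ => by rw [hz]; ring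
        rw [h1, hy.2 r hrV, add_zero]
        refine (abs_dotProduct_le (by positivity) hup hy.1).trans (le_of_eq ?_)
        rw [← hN]
        ring
      have hWQ : (W : ℝ) / Q = W * (1 / Q) := by ring
      have hδ : ((N : ℝ) * R + 1) / Q = N * R / Q + 1 / Q := by ring
      have hNR : (0 : ℝ) ≤ N * R / Q := by positivity
      have hQi : (0 : ℝ) < 1 / Q := by positivity
      -- This absorbs the constant 1 of `1 - z·y` into `γ δ`.
      have hγQ : 1 ≤ γ * (1 / Q) := by
        rw [mul_one_div, le_div_iff₀ hQ0, one_mul]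
        exact hγ
      refine ⟨Or.inr ⟨γ, hγ0, p, hpQ, hpV, fun y hy => ⟨?_, ?_⟩⟩,
        Or.inr ⟨γ, hγ0, fun i => -p i, fun i => by rw [abs_neg]; exact hpQ i, ?_,
          fun y hy => ?_⟩⟩
      · have h1 := hy.2
        rw [hdot] at h1
        have h2 := (abs_le.1 (hp''R y hy.1)).1
        rw [hWQ] at h2
        have h3 : W * (realVec p ⬝ᵥ y) ≤ W * (1 / Q) := by linarith
        have := le_of_mul_le_mul_left h3 hW0
        linarith
      · have h1 := (abs_le.1 (hzu y hy.1)).2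
        rw [hδ, mul_add, mul_add]
        linarith
      · have : realVec (fun i => -p i) = -realVec p := by funext i; simp [realVec]
        rw [this, V.neg_mem_iff]
        exact hpV
      · have hneg : realVec (fun i => -p i) ⬝ᵥ y = -(realVec p ⬝ᵥ y) := by
          have : realVec (fun i => -p i) = -realVec p := by funext i; simp [realVec]
          rw [this, neg_dotProduct]
        rw [hneg]
        constructor
        · have h1 := hy.2
          rw [hdot] at h1
          have h2 := (abs_le.1 (hp''R y hy.1)).2
          rw [hWQ] at h2
          have h3 : W * -(realVec p ⬝ᵥ y) ≤ W * (1 / Q) := by linarith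
          have := le_of_mul_le_mul_left h3 hW0
          linarith
        · have h1 := (abs_le.1 (hzu y hy.1)).1
          rw [hδ, mul_add, mul_add]
          linarith

/-- Every integral functional `z` can be replaced by a bounded one such that the halfspaces
`z ≤ 0` and `z ≥ 1` are reducible to the halfspaces of the replacement. -/
theorem exists_substitution {ι : Type} [Fintype ι] (Q R : ℕ) (hQ : 2 ≤ Q) (hR : 1 ≤ R)
    (z : ι → ℤ) :
    ∃ p' : ι → ℤ, (∀ i, |p' i| ≤ ((Fintype.card ι * R * Q ^ (Fintype.card ι + 1) + 1) ^
          Fintype.card ι * (Q ^ (Fintype.card ι + 1) + Fintype.card ι * Q ^ Fintype.card ι) : ℕ)) ∧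
        ∀ V : Submodule ℝ (ι → ℝ),
          Reducible ((Fintype.card ι * R + 1) / Q) (Q ^ Fintype.card ι) V
            {y | y ∈ boxPerp R V ∧ realVec p' ⬝ᵥ y ≤ 0} (fun y => realVec z ⬝ᵥ y) ∧
          Reducible ((Fintype.card ι * R + 1) / Q) (Q ^ Fintype.card ι) V
            {y | y ∈ boxPerp R V ∧ 1 ≤ realVec p' ⬝ᵥ y} (fun y => 1 - realVec z ⬝ᵥ y) := by
  obtain ⟨p', hp', h⟩ := exists_substitution_aux Q R hQ hR (Fintype.card ι) z (realVec z) 0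
    (fun i => by simp [realVec]) (Finset.card_filter_le _ _) (fun i => by simp)
  exact ⟨p', hp', fun V => h V V.zero_mem⟩

/-! ### Homogenization -/

/-- The homogenization `(x, -1)` of a point. -/
def hat {n : ℕ} (x : Fin n → ℝ) : Option (Fin n) → ℝ := fun o => o.elim (-1) x

/-- The homogeneous coefficient vector `(a, b)` of an inequality. -/
def Ineq.hom {n : ℕ} (e : Ineq n) : Option (Fin n) → ℤ := fun o => o.elim e.b e.a

theorem realVec_dotProduct_hat {n : ℕ} (p : Option (Fin n) → ℤ) (x : Fin n → ℝ) :
    realVec p ⬝ᵥ hat x = ∑ j, (p (some j) : ℝ) * x j - p none := by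
  simp only [dotProduct, Fintype.sum_option, realVec, hat, Option.elim]
  ring

theorem Ineq.mem_halfspace {n : ℕ} (e : Ineq n) (x : Fin n → ℝ) :
    x ∈ e.halfspace ↔ realVec e.hom ⬝ᵥ hat x ≤ 0 := by
  rw [realVec_dotProduct_hat, sub_nonpos]
  rfl

theorem rightIneq_hom_dotProduct_hat {n : ℕ} (a : Fin n → ℤ) (b : ℤ) (x : Fin n → ℝ) :
    realVec (rightIneq a b).hom ⬝ᵥ hat x = 1 - realVec (leftIneq a b).hom ⬝ᵥ hat x := by
  rw [realVec_dotProduct_hat, realVec_dotProduct_hat]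
  simp only [Ineq.hom, rightIneq, leftIneq, Option.elim, Pi.neg_apply]
  push_cast
  simp only [neg_mul, Finset.sum_neg_distrib]
  ring

theorem mem_rightIneq_halfspace {n : ℕ} (a : Fin n → ℤ) (b : ℤ) (x : Fin n → ℝ) :
    x ∈ (rightIneq a b).halfspace ↔ 1 ≤ realVec (leftIneq a b).hom ⬝ᵥ hat x := by
  rw [Ineq.mem_halfspace, rightIneq_hom_dotProduct_hat, sub_nonpos]

theorem leftIneq_hom {n : ℕ} (p : Option (Fin n) → ℤ) :
    (leftIneq (fun j => p (some j)) (p none)).hom = p := by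
  funext o
  cases o <;> rfl

/-! ### Branching proofs with bounded coefficients -/

/-- All labels of the tree have entries of absolute value at most `B`. -/
def BranchTree.Bounded {n : ℕ} (B : ℤ) : BranchTree n → Prop
  | .leaf => True
  | .node a b l r => (∀ j, |a j| ≤ B) ∧ |b| ≤ B ∧ l.Bounded B ∧ r.Bounded B

theorem BranchTree.Bounded.mono {n : ℕ} {B B' : ℤ} (hB : B ≤ B') {T : BranchTree n}
    (h : T.Bounded B) : T.Bounded B' := by
  induction T with
  | leaf => trivial
  | node a b l r hl hr =>
    exact ⟨fun j => (h.1 j).trans hB, h.2.1.trans hB, hl h.2.2.1, hr h.2.2.2⟩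

theorem IsBranchingProof.mono {n : ℕ} {T : BranchTree n} : ∀ {K K' : Set (Fin n → ℝ)}, K' ⊆ K →
    IsBranchingProof K T → IsBranchingProof K' T := by
  induction T with
  | leaf => exact fun h hK => Set.subset_eq_empty h hK
  | node a b l r hl hr =>
    exact fun h hK => ⟨hl (Set.inter_subset_inter_left _ h) hK.1,
      hr (Set.inter_subset_inter_left _ h) hK.2⟩

/-! ### Refuting a leaf -/

/-- If a positive combination of few reducible functionals is positive on `X`, then `X` has a
short branching proof with bounded coefficients. -/
theorem exists_refutation {n : ℕ} {σ : Type} [Fintype σ] (δ : ℝ) (hδ : 0 ≤ δ)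
    (hδn : (n + 1 : ℕ) * (2 * δ) ≤ 1) (B : ℤ) (hσ : Fintype.card σ ≤ n + 1)
    (X : Set (Fin n → ℝ)) (c : σ → ℝ) (hc : ∀ e, 0 < c e) (f : σ → (Option (Fin n) → ℝ) → ℝ)
    (hpos : ∀ x ∈ X, 0 < ∑ e, c e * f e (hat x))
    (hred : ∀ (V : Submodule ℝ (Option (Fin n) → ℝ)) (e : σ),
      Reducible δ B V {y | y ∈ hat '' X ∧ ∀ v ∈ V, v ⬝ᵥ y = 0} (f e)) (s : ℕ) :
    ∀ V : Submodule ℝ (Option (Fin n) → ℝ), n + 1 ≤ Module.finrank ℝ V + s →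
      ∃ T : BranchTree n, IsBranchingProof {x | x ∈ X ∧ ∀ v ∈ V, v ⬝ᵥ hat x = 0} T ∧
        T.length ≤ 4 * s + 1 ∧ T.Bounded (B + 1) := by
  classical
  have hδ2 : 2 * δ ≤ 1 := by
    refine le_trans ?_ hδn
    have : (1 : ℝ) ≤ (n + 1 : ℕ) := by push_cast; linarith [(Nat.cast_nonneg n : (0 : ℝ) ≤ n)]
    nlinarith
  induction s with
  | zero =>
    intro V hV
    refine ⟨.leaf, ?_, le_rfl, trivial⟩
    have htop : V = ⊤ := by
      refine Submodule.eq_top_of_finrank_eq (le_antisymm (Submodule.finrank_le _) ?_)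
      simpa using hV
    refine Set.eq_empty_of_forall_notMem fun x hx => ?_
    have := hx.2 (Pi.single none 1) (htop ▸ Submodule.mem_top)
    simp [hat] at this
  | succ s ih =>
    intro V hV
    set Y : Set (Fin n → ℝ) := {x | x ∈ X ∧ ∀ v ∈ V, v ⬝ᵥ hat x = 0} with hY
    rcases Y.eq_empty_or_nonempty with hemp | ⟨x₀, hx₀⟩
    · exact ⟨.leaf, hemp, by simp [BranchTree.length], trivial⟩
    -- The value `γ = 0` encodes the case `f e ≤ 0`, with `p = 0` as a dummy.
    have hex : ∀ e, ∃ (γ : ℝ) (p : Option (Fin n) → ℤ), 0 ≤ γ ∧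
        (0 < γ → (∀ i, |p i| ≤ B) ∧ realVec p ∉ V ∧ ∀ x ∈ Y, realVec p ⬝ᵥ hat x ≤ δ) ∧
        ∀ x ∈ Y, f e (hat x) ≤ γ * (realVec p ⬝ᵥ hat x + δ) := by
      intro e
      rcases hred V e with h | ⟨γ, hγ, p, hp, hpV, h⟩
      · exact ⟨0, 0, le_rfl, fun h => absurd h (lt_irrefl _), fun x hx => by
          simpa using h (hat x) ⟨⟨x, hx.1, rfl⟩, hx.2⟩⟩
      · exact ⟨γ, p, hγ.le, fun _ => ⟨hp, hpV, fun x hx => (h (hat x) ⟨⟨x, hx.1, rfl⟩, hx.2⟩).1⟩,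
          fun x hx => (h (hat x) ⟨⟨x, hx.1, rfl⟩, hx.2⟩).2⟩
    choose γ p hγ hp hf using hex
    have hle : ∀ x ∈ Y, 0 < ∑ e, c e * γ e * (realVec (p e) ⬝ᵥ hat x + δ) := fun x hx => by
      refine (hpos x hx.1).trans_le (Finset.sum_le_sum fun e _ => ?_)
      rw [mul_assoc]
      exact mul_le_mul_of_nonneg_left (hf e x hx) (hc e).le
    have hne : Nonempty σ := by
      by_contra h
      rw [not_nonempty_iff] at h
      simpa using hle x₀ hx₀
    obtain ⟨e₀, he₀⟩ := Finite.exists_max fun e => c e * γ e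
    have hγ₀ : 0 < γ e₀ := by
      by_contra h
      have h0 : ∀ e, c e * γ e = 0 := fun e => by
        refine le_antisymm ((he₀ e).trans ?_) (mul_nonneg (hc e).le (hγ e))
        exact mul_nonpos_of_nonneg_of_nonpos (hc e₀).le (not_lt.1 h)
      simpa [h0] using hle x₀ hx₀
    obtain ⟨hpB, hpV, hpδ⟩ := hp e₀ hγ₀
    have hm : 0 < c e₀ * γ e₀ := mul_pos (hc e₀) hγ₀
    -- Each of the at most `n` other terms is at most `2δ` times the maximal weight, so positivity
    -- of the sum keeps `p·x̂` above `-(2n + 1)δ`.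
    have hlow : ∀ x ∈ Y, -1 < realVec (p e₀) ⬝ᵥ hat x := by
      intro x hx
      have h1 := hle x hx
      rw [← Finset.add_sum_erase _ _ (Finset.mem_univ e₀)] at h1
      have h2 : ∑ e ∈ Finset.univ.erase e₀, c e * γ e * (realVec (p e) ⬝ᵥ hat x + δ) ≤
          n * (c e₀ * γ e₀ * (2 * δ)) := by
        refine (Finset.sum_le_card_nsmul _ _ (c e₀ * γ e₀ * (2 * δ)) fun e _ => ?_).trans ?_
        · rcases (hγ e).eq_or_lt with h | h
          · rw [← h, mul_zero, zero_mul]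
            positivity
          · refine (mul_le_mul_of_nonneg_left (b := realVec (p e) ⬝ᵥ hat x + δ) (c := 2 * δ) ?_
              (mul_nonneg (hc e).le (hγ e))).trans
              (mul_le_mul_of_nonneg_right (he₀ e) (by positivity))
            linarith [(hp e h).2.2 x hx]
        · rw [nsmul_eq_mul]
          refine mul_le_mul_of_nonneg_right ?_ (by positivity)
          rw [Finset.card_erase_of_mem (Finset.mem_univ _), Finset.card_univ]
          exact_mod_cast (by omega)
      have h3 : 0 < c e₀ * γ e₀ * (realVec (p e₀) ⬝ᵥ hat x + δ + n * (2 * δ)) := by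
        linarith
      have h4 := (pos_iff_pos_of_mul_pos h3).1 hm
      push_cast at hδn
      linarith
    have hupp : ∀ x ∈ Y, realVec (p e₀) ⬝ᵥ hat x < 1 := fun x hx => by
      linarith [hpδ x hx]
    obtain ⟨T, hT, hlen, hTB⟩ := ih (V ⊔ Submodule.span ℝ {realVec (p e₀)}) (by
      have hlt : Module.finrank ℝ V <
          Module.finrank ℝ (V ⊔ Submodule.span ℝ {realVec (p e₀)} : Submodule ℝ _) := by
        refine Submodule.finrank_lt_finrank_of_lt (lt_of_le_of_ne le_sup_left fun h => hpV ?_)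
        rw [h]
        exact (le_sup_right : Submodule.span ℝ {realVec (p e₀)} ≤ _)
          (Submodule.mem_span_singleton_self _)
      omega)
    have hmul : ∀ x, x ∈ (leftIneq (fun j => p e₀ (some j)) (p e₀ none)).halfspace ↔
        realVec (p e₀) ⬝ᵥ hat x ≤ 0 := fun x => by
      rw [Ineq.mem_halfspace, leftIneq_hom]
    have hml : ∀ x, x ∈ (leftIneq (fun j => p e₀ (some j)) (p e₀ none - 1)).halfspace ↔
        realVec (p e₀) ⬝ᵥ hat x ≤ -1 := fun x => by
      rw [Ineq.mem_halfspace, realVec_dotProduct_hat, realVec_dotProduct_hat]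
      simp only [Ineq.hom, leftIneq, Option.elim]
      push_cast
      constructor <;> intro h <;> linarith
    have hmr : ∀ x, x ∈ (rightIneq (fun j => p e₀ (some j)) (p e₀ none - 1)).halfspace ↔
        0 ≤ realVec (p e₀) ⬝ᵥ hat x := fun x => by
      rw [mem_rightIneq_halfspace, realVec_dotProduct_hat, realVec_dotProduct_hat]
      simp only [Ineq.hom, leftIneq, Option.elim]
      push_cast
      constructor <;> intro h <;> linarith
    -- Two splits, `p·x̂ ≤ -1` or `≥ 0`, then `≤ 0` or `≥ 1`: both outer leaves are empty. The
    -- right-hand side `p none - 1` accounts for the bound `B + 1`, and the four new nodes for the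
    -- length `4 s + 1`.
    refine ⟨.node (fun j => p e₀ (some j)) (p e₀ none - 1) .leaf
      (.node (fun j => p e₀ (some j)) (p e₀ none) T .leaf), ⟨?_, ?_, ?_⟩, ?_,
      fun j => (hpB _).trans (by omega), ?_, trivial, fun j => (hpB _).trans (by omega),
      (hpB _).trans (by omega), hTB, trivial⟩
    · refine Set.eq_empty_of_forall_notMem fun x hx => ?_
      have := (hml x).1 hx.2
      linarith [hlow x hx.1]
    · refine IsBranchingProof.mono (fun x hx => ?_) hT
      refine ⟨hx.1.1.1, fun v hv => ?_⟩
      obtain ⟨v₁, hv₁, v₂, hv₂, rfl⟩ := Submodule.mem_sup.1 hv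
      obtain ⟨t, rfl⟩ := Submodule.mem_span_singleton.1 hv₂
      have h0 : realVec (p e₀) ⬝ᵥ hat x = 0 :=
        le_antisymm ((hmul x).1 hx.2) ((hmr x).1 hx.1.2)
      rw [add_dotProduct, smul_dotProduct, hx.1.1.2 v₁ hv₁, h0]
      simp
    · refine Set.eq_empty_of_forall_notMem fun x hx => ?_
      have := hx.2
      rw [mem_rightIneq_halfspace, leftIneq_hom] at this
      linarith [hupp x hx.1.1]
    · simp only [BranchTree.length]
      omega
    · refine (abs_sub _ _).trans ?_
      have := hpB none
      simpa using this

/-! ### Certificates for systems with rational rows and integral cuts -/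

/-- The polyhedron `C x ≤ d` cut by the inequalities of `E`. -/
def cutPolyhedron {m n k : ℕ} (C : Matrix (Fin m) (Fin n) ℚ) (d : Fin m → ℚ) (E : Fin k → Ineq n) :
    Set (Fin n → ℝ) :=
  {x | x ∈ polyhedron C d ∧ ∀ i, x ∈ (E i).halfspace}

theorem cutPolyhedron_elim0 {m n : ℕ} (C : Matrix (Fin m) (Fin n) ℚ) (d : Fin m → ℚ) :
    cutPolyhedron C d Fin.elim0 = polyhedron C d := by
  ext x
  exact ⟨fun h => h.1, fun h => ⟨h, fun i => i.elim0⟩⟩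

theorem cutPolyhedron_snoc {m n k : ℕ} (C : Matrix (Fin m) (Fin n) ℚ) (d : Fin m → ℚ)
    (E : Fin k → Ineq n) (e : Ineq n) :
    cutPolyhedron C d (Fin.snoc E e) = cutPolyhedron C d E ∩ e.halfspace := by
  ext x
  simp only [cutPolyhedron, Set.mem_ofPred_eq, Set.mem_inter_iff]
  constructor
  · rintro ⟨h1, h2⟩
    refine ⟨⟨h1, fun i => ?_⟩, ?_⟩
    · have := h2 i.castSucc
      rwa [Fin.snoc_castSucc] at this
    · have := h2 (Fin.last k)
      rwa [Fin.snoc_last] at this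
  · rintro ⟨⟨h1, h2⟩, h3⟩
    refine ⟨h1, fun i => ?_⟩
    refine Fin.lastCases ?_ (fun i => ?_) i
    · rwa [Fin.snoc_last]
    · rw [Fin.snoc_castSucc]; exact h2 i

/-- Clearing denominators by `D` makes the rows integral, so `exists_sparse_farkas` applies. Neither
`d` nor the right-hand sides of `E` enter the bound on the multipliers. -/
theorem exists_certificate {m n k : ℕ} (C : Matrix (Fin m) (Fin n) ℚ) (d : Fin m → ℚ)
    (E : Fin k → Ineq n) (D : ℕ) (hD : 0 < D) (C' : Fin m → Fin n → ℤ)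
    (hC' : ∀ i j, (C' i j : ℚ) = D * C i j) (H : ℕ) (hH : 1 ≤ H) (hC'H : ∀ i j, |C' i j| ≤ H)
    (hEH : ∀ i j, |(E i).a j| ≤ H) (hempty : cutPolyhedron C d E = ∅) :
    ∃ lam : Fin (m + k) → ℤ, IsFarkasCertificate C d E (fun i => lam i) ∧
      (Finset.univ.filter fun i => lam i ≠ 0).card ≤ n + 1 ∧
      ∀ i, lam i ≤ (D * ((n + 1) * H) ^ n : ℕ) := by
  have hD0 : (0 : ℚ) < D := by exact_mod_cast hD
  obtain ⟨w, hw0, hwa, hwb, hcard, hwH⟩ := exists_sparse_farkas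
    (fun s : Fin (m + k) => Fin.addCases C' (fun e => (E e).a) s)
    (fun s => Fin.addCases (motive := fun _ => ℚ) (fun i => D * d i) (fun e => (E e).b) s) H hH
    (fun s j => by
      refine Fin.addCases (fun i => ?_) (fun e => ?_) s
      · rw [Fin.addCases_left]; exact hC'H i j
      · rw [Fin.addCases_right]; exact hEH e j) (by
      rintro ⟨x, hx⟩
      have hmem : (fun j => (x j : ℝ)) ∈ cutPolyhedron C d E := by
        refine ⟨fun i => ?_, fun e => ?_⟩
        · have := hx (Fin.castAdd k i)
          simp only [Fin.addCases_left, hC', mul_assoc] at this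
          rw [← Finset.mul_sum, mul_le_mul_iff_right₀ hD0] at this
          have h : ((∑ j, C i j * x j : ℚ) : ℝ) ≤ d i := Rat.cast_le.2 this
          push_cast at h
          exact h
        · have := hx (Fin.natAdd m e)
          simp only [Fin.addCases_right] at this
          have h : ((∑ j, ((E e).a j : ℚ) * x j : ℚ) : ℝ) ≤ ((E e).b : ℚ) := Rat.cast_le.2 this
          push_cast at h
          exact h
      rw [hempty] at hmem
      exact hmem)
  -- Multipliers found for the scaled rows `D C` are multiplied by `D` to serve for `C`; those of
  -- the cuts are unchanged.
  let lam : Fin (m + k) → ℤ :=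
    fun s => Fin.addCases (motive := fun _ => ℤ) (fun _ => (D : ℤ)) (fun _ => 1) s * w s
  have hl : ∀ i, lam (Fin.castAdd k i) = D * w (Fin.castAdd k i) := fun i => by
    simp only [lam, Fin.addCases_left]
  have hr : ∀ e, lam (Fin.natAdd m e) = w (Fin.natAdd m e) := fun e => by
    simp only [lam, Fin.addCases_right, one_mul]
  refine ⟨lam, ⟨fun s => ?_, fun j => ?_, ?_⟩, ?_, fun s => ?_⟩
  · refine Fin.addCases (fun i => ?_) (fun e => ?_) s
    · exact Int.cast_nonneg (by rw [hl]; exact mul_nonneg (Int.natCast_nonneg D) (hw0 _))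
    · exact Int.cast_nonneg (by rw [hr]; exact hw0 _)
  · have := hwa j
    rw [Fin.sum_univ_add] at this
    simp only [Fin.addCases_left, Fin.addCases_right] at this
    have h2 : (((∑ i, w (Fin.castAdd k i) * C' i j + ∑ e, w (Fin.natAdd m e) * (E e).a j : ℤ)) : ℚ)
        = 0 := by rw [this]; simp
    rw [← h2]
    push_cast
    simp only [hl, hr, hC']
    push_cast
    congr 1
    exact Finset.sum_congr rfl fun i _ => by ring
  · refine lt_of_eq_of_lt ?_ hwb
    rw [Fin.sum_univ_add]
    simp only [Fin.addCases_left, Fin.addCases_right, hl, hr]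
    push_cast
    congr 1
    exact Finset.sum_congr rfl fun i _ => by ring
  · refine le_trans (Finset.card_le_card fun s hs => ?_) hcard
    simp only [Finset.mem_filter, Finset.mem_univ, true_and] at hs ⊢
    exact fun h => hs (by simp only [lam, h, mul_zero])
  · have hb : (0 : ℤ) ≤ (((n + 1) * H) ^ n : ℕ) := by positivity
    have hD1 : (1 : ℤ) ≤ D := by exact_mod_cast hD
    rw [Nat.cast_mul]
    refine Fin.addCases (fun i => ?_) (fun e => ?_) s
    · rw [hl]; exact mul_le_mul_of_nonneg_left (hwH _) (by positivity)
    · rw [hr]; exact (hwH _).trans (le_mul_of_one_le_left hb hD1)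

/-! ### Bit-size estimates for rationals -/

theorem den_le_two_pow (r : ℚ) : r.den ≤ 2 ^ bitsRat r := by
  refine (Nat.le_succ _).trans ((Nat.le_pow_clog one_lt_two (r.den + 1)).trans ?_)
  exact Nat.pow_le_pow_right two_pos (by rw [bitsRat]; omega)

theorem natAbs_num_le_two_pow (r : ℚ) : r.num.natAbs ≤ 2 ^ bitsRat r := by
  refine (Nat.le_succ _).trans ((Nat.le_pow_clog one_lt_two (r.num.natAbs + 1)).trans ?_)
  exact Nat.pow_le_pow_right two_pos (by rw [bitsRat]; omega)

theorem abs_le_two_pow_bitsRat (r : ℚ) : |r| ≤ 2 ^ bitsRat r := by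
  rw [Rat.abs_def, Rat.divInt_eq_div]
  refine (div_le_self (by positivity) (by exact_mod_cast r.den_pos)).trans ?_
  exact_mod_cast natAbs_num_le_two_pow r

theorem bitsRat_le_bitsVec {n : ℕ} (c : Fin n → ℚ) (i : Fin n) : bitsRat (c i) ≤ bitsVec c :=
  (Finset.single_le_sum (f := fun i => bitsRat (c i)) (fun _ _ => Nat.zero_le _)
    (Finset.mem_univ i)).trans (Nat.le_add_left _ _)

theorem bitsRat_le_bitsMat {m n : ℕ} (A : Matrix (Fin m) (Fin n) ℚ) (i : Fin m) (j : Fin n) :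
    bitsRat (A i j) ≤ bitsMat A := by
  refine le_trans ?_ (Nat.le_add_left _ _)
  refine (Finset.single_le_sum (f := fun j => bitsRat (A i j)) (fun _ _ => Nat.zero_le _)
    (Finset.mem_univ j)).trans ?_
  exact Finset.single_le_sum (f := fun i => ∑ j, bitsRat (A i j)) (fun _ _ => Nat.zero_le _)
    (Finset.mem_univ i)

/-- A rational matrix has a common denominator of bounded size. -/
theorem exists_integral_scaling {m n : ℕ} (A : Matrix (Fin m) (Fin n) ℚ) :
    ∃ D : ℕ, 0 < D ∧ D ≤ 2 ^ bitsMat A ∧ ∃ A' : Fin m → Fin n → ℤ,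
      (∀ i j, (A' i j : ℚ) = D * A i j) ∧ ∀ i j, |A' i j| ≤ (2 ^ (2 * bitsMat A) : ℕ) := by
  have hD : ∏ i, ∏ j, (A i j).den ≤ 2 ^ bitsMat A := by
    calc ∏ i, ∏ j, (A i j).den ≤ ∏ i, ∏ j, 2 ^ bitsRat (A i j) :=
          Finset.prod_le_prod' fun i _ => Finset.prod_le_prod' fun j _ => den_le_two_pow _
      _ = 2 ^ ∑ i, ∑ j, bitsRat (A i j) := by simp only [Finset.prod_pow_eq_pow_sum]
      _ ≤ 2 ^ bitsMat A := Nat.pow_le_pow_right two_pos (Nat.le_add_left _ _)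
  have hdvd : ∀ i j, (A i j).den ∣ ∏ i, ∏ j, (A i j).den := fun i j =>
    (Finset.dvd_prod_of_mem (fun j => (A i j).den) (Finset.mem_univ j)).trans
      (Finset.dvd_prod_of_mem (fun i => ∏ j, (A i j).den) (Finset.mem_univ i))
  refine ⟨∏ i, ∏ j, (A i j).den,
    Finset.prod_pos fun i _ => Finset.prod_pos fun j _ => (A i j).den_pos, hD, ?_⟩
  generalize (∏ i, ∏ j, (A i j).den) = D at hD hdvd
  choose c hc using hdvd
  refine ⟨fun i j => (A i j).num * c i j, fun i j => ?_, fun i j => ?_⟩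
  · have h : (D : ℚ) = (A i j).den * c i j := by exact_mod_cast hc i j
    have h2 : ((A i j).num : ℚ) = A i j * (A i j).den := (Rat.mul_den_eq_num _).symm
    push_cast
    rw [h, h2]
    ring
  · have h1 : c i j ≤ D := by
      rw [hc i j]; exact Nat.le_mul_of_pos_left _ (A i j).den_pos
    have h2 : (A i j).num.natAbs ≤ 2 ^ bitsMat A :=
      (natAbs_num_le_two_pow _).trans (Nat.pow_le_pow_right two_pos (bitsRat_le_bitsMat A i j))
    rw [abs_mul, Nat.abs_cast, Int.abs_eq_natAbs, two_mul, pow_add]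
    exact_mod_cast Nat.mul_le_mul h2 (h1.trans hD)

/-! ### Bounded polyhedra -/

theorem polyhedron_rows_pos {m n : ℕ} (hn : 1 ≤ n) (C : Matrix (Fin m) (Fin n) ℚ) (d : Fin m → ℚ)
    (hbd : Bornology.IsBounded (polyhedron C d)) : 1 ≤ m := by
  by_contra hm
  obtain rfl : m = 0 := by omega
  have huniv : polyhedron C d = Set.univ := Set.eq_univ_of_forall fun x i => i.elim0
  rw [huniv] at hbd
  have : Nonempty (Fin n) := ⟨⟨0, hn⟩⟩
  exact NormedSpace.unbounded_univ ℝ (Fin n → ℝ) hbd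

/-- Boundedness makes a cut `±x j ≥ ⌊r⌋ + 1` infeasible for some unknown `r`. The multipliers
refuting it are bounded independently of `r`, and their part on `C x ≤ d` is an explicit bound for
`±x j`. -/
theorem abs_le_of_mem_polyhedron {m n : ℕ} (hn : 1 ≤ n) (C : Matrix (Fin m) (Fin n) ℚ)
    (d : Fin m → ℚ) (hbd : Bornology.IsBounded (polyhedron C d)) (x : Fin n → ℝ)
    (hx : x ∈ polyhedron C d) (j : Fin n) :
    |x j| ≤ (2 ^ (6 * n * (bitsMat C + bitsVec d)) : ℕ) := by
  obtain ⟨D, hD, hDb, C', hC', hC'b⟩ := exists_integral_scaling C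
  have hm := polyhedron_rows_pos hn C d hbd
  obtain ⟨ε, hε, hεx⟩ : ∃ ε : ℤ, (ε = 1 ∨ ε = -1) ∧ |x j| = ε * x j := by
    rcases abs_choice (x j) with h | h
    · exact ⟨1, Or.inl rfl, by simpa using h⟩
    · exact ⟨-1, Or.inr rfl, by simpa using h⟩
  have hε' : |ε| = 1 := by rcases hε with rfl | rfl <;> simp
  obtain ⟨r, hr⟩ := hbd.exists_norm_le
  let e : Ineq n := ⟨Pi.single j (-ε), -(⌊r⌋ + 1)⟩
  have he : ∀ y : Fin n → ℝ, ∑ i, (e.a i : ℝ) * y i = -(ε * y j) := fun y => by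
    rw [Finset.sum_eq_single j]
    · simp [e]
    · intro i _ hi; simp [e, hi]
    · simp
  have hempty : cutPolyhedron C d (fun _ : Fin 1 => e) = ∅ := by
    refine Set.eq_empty_of_forall_notMem fun y hy => ?_
    have h1 : -(ε * y j) ≤ ((-(⌊r⌋ + 1) : ℤ) : ℝ) := by
      rw [← he y]; exact hy.2 0
    have h2 : ε * y j ≤ r := by
      refine (le_abs_self _).trans ?_
      rw [abs_mul, ← Int.cast_abs, hε', Int.cast_one, one_mul]
      exact (norm_le_pi_norm y j).trans (hr y hy.1)
    push_cast at h1
    linarith [Int.lt_floor_add_one r]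
  obtain ⟨lam, ⟨hl0, hla, hlb⟩, -, hlam⟩ := exists_certificate C d (fun _ : Fin 1 => e) D hD C' hC'
    (2 ^ (2 * bitsMat C)) (Nat.one_le_two_pow) hC'b (fun _ i => by
      by_cases hi : i = j
      · subst hi
        simp only [e, Pi.single_eq_same, abs_neg, hε']
        exact_mod_cast Nat.one_le_two_pow
      · simp [e, hi]) hempty
  have hl0' : ∀ i, 0 ≤ lam i := fun i => by
    exact_mod_cast (show (0 : ℚ) ≤ (lam i : ℚ) from hl0 i)
  simp only [Finset.univ_unique, Fin.default_eq_zero, Finset.sum_singleton] at hla hlb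
  set μ : ℤ := lam (Fin.natAdd m 0) with hμ
  have hcomb : ∑ i, (lam (Fin.castAdd 1 i) : ℝ) * ∑ l, (C i l : ℝ) * x l = μ * (ε * x j) := by
    have h1 : ∀ l, ∑ i, (lam (Fin.castAdd 1 i) : ℝ) * C i l = -(μ * e.a l) := fun l => by
      have h : ((∑ i, (lam (Fin.castAdd 1 i) : ℚ) * C i l + μ * (e.a l : ℚ) : ℚ) : ℝ) = 0 := by
        rw [hla l]; simp
      push_cast at h
      linarith
    calc _ = ∑ l, (∑ i, (lam (Fin.castAdd 1 i) : ℝ) * C i l) * x l := by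
          simp only [Finset.mul_sum, Finset.sum_mul]
          rw [Finset.sum_comm]
          simp only [mul_assoc]
      _ = -(μ * ∑ l, (e.a l : ℝ) * x l) := by
          simp only [h1, Finset.mul_sum, ← Finset.sum_neg_distrib]
          exact Finset.sum_congr rfl fun l _ => by ring
      _ = _ := by rw [he]; ring
  have hle : (μ : ℝ) * (ε * x j) ≤ ∑ i, (lam (Fin.castAdd 1 i) : ℝ) * d i := by
    rw [← hcomb]
    exact Finset.sum_le_sum fun i _ =>
      mul_le_mul_of_nonneg_left (hx i) (by exact_mod_cast hl0' (Fin.castAdd 1 i))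
  have hμ0 : 0 ≤ μ := hl0' _
  -- With `μ = 0` the certificate would refute `C x ≤ d` itself, which contains `x`; integrality
  -- then gives `μ ≥ 1`.
  have hμ1 : 1 ≤ μ := by
    by_contra h
    have h0 : μ = 0 := by omega
    rw [h0] at hle hlb
    have h : ((∑ i, (lam (Fin.castAdd 1 i) : ℚ) * d i : ℚ) : ℝ) < 0 := by
      have := hlb
      rw [Int.cast_zero, zero_mul, add_zero] at this
      exact_mod_cast this
    push_cast at h hle
    linarith
  set M := bitsMat C
  set L := bitsMat C + bitsVec d with hL
  have hML : M ≤ L := Nat.le_add_right _ _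
  have hnL : n ≤ L := by
    have : n ≤ m * n := Nat.le_mul_of_pos_left n hm
    have : m * n ≤ M := Nat.le_add_right _ _
    omega
  have hmL : m ≤ L := by
    have : m ≤ bitsVec d := Nat.le_add_right _ _
    omega
  have hn1 : n + 1 ≤ 2 ^ n := Nat.lt_two_pow_self
  have hlamb : ∀ i, (lam i : ℝ) ≤ (2 ^ (L + n * (n + 2 * L)) : ℕ) := fun i => by
    have h := hlam i
    refine (Int.cast_le.2 h).trans ?_
    rw [Int.cast_natCast, Nat.cast_le, pow_add, mul_comm n (n + 2 * L), pow_mul 2 (n + 2 * L),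
      pow_add 2 n]
    exact Nat.mul_le_mul (hDb.trans (Nat.pow_le_pow_right two_pos hML))
      (Nat.pow_le_pow_left (Nat.mul_le_mul hn1 (Nat.pow_le_pow_right two_pos (by omega))) n)
  calc |x j| = ε * x j := hεx
    _ ≤ μ * (ε * x j) := le_mul_of_one_le_left (hεx ▸ abs_nonneg _) (by exact_mod_cast hμ1)
    _ ≤ ∑ i, (lam (Fin.castAdd 1 i) : ℝ) * d i := hle
    _ ≤ ∑ _i : Fin m, ((2 ^ (L + n * (n + 2 * L)) : ℕ) : ℝ) * (2 ^ L : ℕ) := by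
        refine Finset.sum_le_sum fun i _ => ?_
        have h1 : |(d i : ℝ)| ≤ (2 ^ L : ℕ) := by
          have h2 := (abs_le_two_pow_bitsRat (d i)).trans
            (pow_le_pow_right₀ one_le_two ((bitsRat_le_bitsVec d i).trans (Nat.le_add_left _ M)))
          have h3 : ((|d i| : ℚ) : ℝ) ≤ ((2 ^ L : ℚ) : ℝ) := Rat.cast_le.2 h2
          push_cast at h3 ⊢
          exact h3
        refine (mul_le_mul_of_nonneg_left ((le_abs_self _).trans h1)
          (by exact_mod_cast hl0' (Fin.castAdd 1 i))).trans ?_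
        exact mul_le_mul_of_nonneg_right (hlamb _) (by positivity)
    _ = ((m * (2 ^ (L + n * (n + 2 * L)) * 2 ^ L) : ℕ) : ℝ) := by simp
    _ ≤ _ := by
        rw [Nat.cast_le]
        have : m ≤ 2 ^ L := hmL.trans Nat.lt_two_pow_self.le
        refine (Nat.mul_le_mul_right _ this).trans ?_
        rw [← pow_add, ← pow_add]
        refine Nat.pow_le_pow_right two_pos ?_
        have h1 : n * n ≤ n * L := Nat.mul_le_mul_left n hnL
        have h2 : L ≤ n * L := Nat.le_mul_of_pos_left L hn
        have h3 : n * (n + 2 * L) = n * n + 2 * (n * L) := by ring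
        rw [h3, mul_assoc]
        omega

/-! ### Recompilation with bounded coefficients -/

/-- Induction over `T` follows two systems at once: `E` lists the original inequalities of the path,
while `X` is cut out by the substituted ones. Points of `X` may violate `E`, but every functional of
`E` stays reducible on `X` for each `V`, which is what a leaf needs. -/
theorem exists_recompilation_aux {m n : ℕ} (C : Matrix (Fin m) (Fin n) ℚ) (d : Fin m → ℚ)
    (Q R : ℕ) (hQ : 2 ≤ Q) (hR : 1 ≤ R) (hbox : ∀ x ∈ polyhedron C d, ∀ j, |x j| ≤ R)
    (hδ : (n + 1 : ℕ) * (2 * ((((n + 1 : ℕ) : ℝ) * R + 1) / Q)) ≤ 1) (A : ℤ)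
    (hA : (((n + 1) * R * Q ^ (n + 2) + 1) ^ (n + 1) * (Q ^ (n + 2) + (n + 1) * Q ^ (n + 1)) : ℕ)
      ≤ A) (hA' : (Q : ℤ) ^ (n + 1) + 1 ≤ A) (T : BranchTree n) :
    ∀ {k : ℕ} (E : Fin k → Ineq n) (X : Set (Fin n → ℝ)), X ⊆ polyhedron C d →
      (∀ (V : Submodule ℝ (Option (Fin n) → ℝ)) (i : Fin k),
        Reducible ((((n + 1 : ℕ) : ℝ) * R + 1) / Q) (Q ^ (n + 1)) V
          {y | y ∈ hat '' X ∧ ∀ v ∈ V, v ⬝ᵥ y = 0} (fun y => realVec (E i).hom ⬝ᵥ y)) →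
      IsBranchingProof (cutPolyhedron C d E) T →
      ∃ T' : BranchTree n, IsBranchingProof X T' ∧ T'.length ≤ (4 * (n + 1) + 1) * T.length ∧
        T'.Bounded A := by
  classical
  have hcardι : Fintype.card (Option (Fin n)) = n + 1 := by simp
  induction T with
  | leaf =>
    intro k E X hX hred hT
    obtain ⟨D, hD, -, C', hC', hC'b⟩ := exists_integral_scaling C
    -- Any bound on the original labels will do: only the sparsity of the certificate is used here,
    -- not its size.
    obtain ⟨H, hH⟩ : ∃ H : ℕ, ∀ i j, |(E i).a j| ≤ H := by
      refine ⟨∑ i, ∑ j, ((E i).a j).natAbs, fun i j => ?_⟩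
      rw [Int.abs_eq_natAbs]
      exact_mod_cast (Finset.single_le_sum (f := fun j => ((E i).a j).natAbs)
        (fun _ _ => Nat.zero_le _) (Finset.mem_univ j)).trans
        (Finset.single_le_sum (f := fun i => ∑ j, ((E i).a j).natAbs)
          (fun _ _ => Nat.zero_le _) (Finset.mem_univ i))
    obtain ⟨lam, ⟨hl0, hla, hlb⟩, hcard, -⟩ := exists_certificate C d E D hD C' hC'
      (H + 2 ^ (2 * bitsMat C)) (Nat.one_le_two_pow.trans (Nat.le_add_left _ _))
      (fun i j => (hC'b i j).trans (by exact_mod_cast Nat.le_add_left _ _))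
      (fun i j => (hH i j).trans (by exact_mod_cast Nat.le_add_right _ _)) hT
    have hl0' : ∀ i, 0 ≤ lam i := fun i => by
      exact_mod_cast (show (0 : ℚ) ≤ (lam i : ℚ) from hl0 i)
    let σ := {e : Fin k // lam (Fin.natAdd m e) ≠ 0}
    obtain ⟨T', hT', hlen, hTB⟩ := exists_refutation (σ := σ) _ (by positivity) hδ (Q ^ (n + 1))
      (by
        rw [Fintype.card_subtype, ← Finset.card_map (Fin.natAddEmb m)]
        refine le_trans (Finset.card_le_card fun s hs => ?_) hcard
        obtain ⟨e, he, rfl⟩ := Finset.mem_map.1 hs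
        simpa using he)
      X (fun e => (lam (Fin.natAdd m e.1) : ℝ))
      (fun e => by
        exact_mod_cast lt_of_le_of_ne (hl0' (Fin.natAdd m e.1)) e.2.symm)
      (fun e y => realVec (E e.1).hom ⬝ᵥ y)
      (fun x hx => by
        have h1 : ∑ e : σ, (lam (Fin.natAdd m e.1) : ℝ) * realVec (E e.1).hom ⬝ᵥ hat x =
            ∑ e, (lam (Fin.natAdd m e) : ℝ) * realVec (E e).hom ⬝ᵥ hat x := by
          rw [← Finset.sum_subtype (Finset.univ.filter fun e => lam (Fin.natAdd m e) ≠ 0) (by simp)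
            (fun e => (lam (Fin.natAdd m e) : ℝ) * realVec (E e).hom ⬝ᵥ hat x)]
          refine Finset.sum_filter_of_ne fun e _ he h0 => he ?_
          rw [h0, Int.cast_zero, zero_mul]
        rw [h1]
        have h2 : ∀ l, ∑ i, (lam (Fin.castAdd k i) : ℝ) * C i l =
            -∑ e, (lam (Fin.natAdd m e) : ℝ) * (E e).a l := fun l => by
          have h : ((∑ i, (lam (Fin.castAdd k i) : ℚ) * C i l +
              ∑ e, (lam (Fin.natAdd m e) : ℚ) * ((E e).a l : ℚ) : ℚ) : ℝ) = 0 := by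
            rw [hla l]; simp
          push_cast at h
          linarith
        have h3 : ∑ i, (lam (Fin.castAdd k i) : ℝ) * ∑ l, (C i l : ℝ) * x l =
            -∑ e, (lam (Fin.natAdd m e) : ℝ) * ∑ l, ((E e).a l : ℝ) * x l := by
          calc _ = ∑ l, (∑ i, (lam (Fin.castAdd k i) : ℝ) * C i l) * x l := by
                simp only [Finset.mul_sum, Finset.sum_mul]
                rw [Finset.sum_comm]
                simp only [mul_assoc]
            _ = _ := by
                simp only [h2, Finset.mul_sum, Finset.sum_mul, neg_mul, Finset.sum_neg_distrib]
                rw [Finset.sum_comm]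
                simp only [mul_assoc]
        have h4 : ∑ i, (lam (Fin.castAdd k i) : ℝ) * ∑ l, (C i l : ℝ) * x l ≤
            ∑ i, (lam (Fin.castAdd k i) : ℝ) * d i := Finset.sum_le_sum fun i _ =>
          mul_le_mul_of_nonneg_left (hX hx i) (by exact_mod_cast hl0' (Fin.castAdd k i))
        have h5 : ((∑ i, (lam (Fin.castAdd k i) : ℚ) * d i +
            ∑ e, (lam (Fin.natAdd m e) : ℚ) * ((E e).b : ℚ) : ℚ) : ℝ) < (0 : ℚ) :=
          Rat.cast_lt.2 hlb
        push_cast at h5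
        simp only [realVec_dotProduct_hat, mul_sub, Finset.sum_sub_distrib, Ineq.hom, Option.elim]
        linarith)
      (fun V e => hred V e.1) (n + 1) ⊥ (Nat.le_add_left _ _)
    refine ⟨T', IsBranchingProof.mono (fun x hx => ?_) hT', by
      simpa [BranchTree.length] using hlen, hTB.mono hA'⟩
    refine ⟨hx, fun v hv => ?_⟩
    rw [(Submodule.mem_bot ℝ).1 hv, zero_dotProduct]
  | node a b l r hl hr =>
    intro k E X hX hred hT
    obtain ⟨p, hp, hpV⟩ := exists_substitution Q R hQ hR (leftIneq a b).hom
    rw [hcardι] at hp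
    simp only [hcardι] at hpV
    have hhat : ∀ x ∈ X, ∀ i, |hat x i| ≤ R := fun x hx i => by
      cases i with
      | none => simpa [hat] using hR
      | some j => exact hbox x (hX hx) j
    have hext : ∀ (e' e : Ineq n) (f : (Option (Fin n) → ℝ) → ℝ)
        (Y : Submodule ℝ (Option (Fin n) → ℝ) → Set (Option (Fin n) → ℝ)),
        (∀ V, Reducible ((((n + 1 : ℕ) : ℝ) * R + 1) / Q) (Q ^ (n + 1)) V (Y V) f) →
        (∀ V x, x ∈ X → x ∈ e'.halfspace → (∀ v ∈ V, v ⬝ᵥ hat x = 0) → hat x ∈ Y V) →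
        (∀ x, realVec e.hom ⬝ᵥ hat x = f (hat x)) →
        ∀ (V : Submodule ℝ (Option (Fin n) → ℝ)) (i : Fin (k + 1)),
          Reducible ((((n + 1 : ℕ) : ℝ) * R + 1) / Q) (Q ^ (n + 1)) V
            {y | y ∈ hat '' (X ∩ e'.halfspace) ∧ ∀ v ∈ V, v ⬝ᵥ y = 0}
            (fun y => realVec ((Fin.snoc E e : Fin (k + 1) → Ineq n) i).hom ⬝ᵥ y) := by
      intro e' e f Y hf hY hef V i
      refine Fin.lastCases ?_ (fun i => ?_) i
      · rw [Fin.snoc_last]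
        refine (hf V).mono ?_ ?_
        · rintro _ ⟨⟨x, hx, rfl⟩, hxV⟩
          exact hY V x hx.1 hx.2 hxV
        · rintro _ ⟨⟨x, hx, rfl⟩, hxV⟩
          exact hef x
      · rw [Fin.snoc_castSucc]
        refine (hred V i).mono ?_ fun y _ => rfl
        rintro _ ⟨⟨x, hx, rfl⟩, hxV⟩
        exact ⟨⟨x, hx.1, rfl⟩, hxV⟩
    obtain ⟨l', hl1, hl2, hl3⟩ := hl (Fin.snoc E (leftIneq a b))
      (X ∩ (leftIneq (fun j => p (some j)) (p none)).halfspace)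
      (fun x hx => hX hx.1)
      (hext _ _ _ _ (fun V => (hpV V).1) (fun V x hx hxe hxV => ⟨⟨hhat x hx, hxV⟩, by
        rwa [Ineq.mem_halfspace, leftIneq_hom] at hxe⟩) fun x => rfl)
      (by rw [cutPolyhedron_snoc]; exact hT.1)
    obtain ⟨r', hr1, hr2, hr3⟩ := hr (Fin.snoc E (rightIneq a b))
      (X ∩ (rightIneq (fun j => p (some j)) (p none)).halfspace)
      (fun x hx => hX hx.1)
      (hext _ _ _ _ (fun V => (hpV V).2) (fun V x hx hxe hxV => ⟨⟨hhat x hx, hxV⟩, by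
        rwa [mem_rightIneq_halfspace, leftIneq_hom] at hxe⟩)
        fun x => rightIneq_hom_dotProduct_hat a b x)
      (by rw [cutPolyhedron_snoc]; exact hT.2)
    refine ⟨.node (fun j => p (some j)) (p none) l' r', ⟨hl1, hr1⟩, ?_,
      fun j => (hp _).trans hA, (hp _).trans hA, hl3, hr3⟩
    simp only [BranchTree.length]
    rw [mul_add, mul_add, mul_one]
    omega

/-- Branching proofs for polyhedra in a box can be recompiled with bounded coefficients. -/
theorem exists_recompilation {m n : ℕ} (C : Matrix (Fin m) (Fin n) ℚ) (d : Fin m → ℚ)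
    (ρ : ℕ) (hbox : ∀ x ∈ polyhedron C d, ∀ j, |x j| ≤ (2 ^ ρ : ℕ)) (T : BranchTree n)
    (hT : IsBranchingProof (polyhedron C d) T) :
    ∃ T' : BranchTree n, IsBranchingProof (polyhedron C d) T' ∧
      T'.length ≤ (4 * (n + 1) + 1) * T.length ∧
      T'.Bounded ((2 ^ ((2 * n + ρ + 2) * ((n + 2) * (n + 3))) : ℕ) : ℤ) := by
  -- `Q = 2 ^ q` is chosen to satisfy `2 (n + 1) ((n + 1) R + 1) ≤ Q`, that is, `2 (n + 1) δ ≤ 1`.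
  set q := 2 * n + ρ + 2 with hq
  have hQ1 : 1 ≤ 2 ^ q := Nat.one_le_two_pow
  have hn1 : n + 1 ≤ 2 ^ n := Nat.lt_two_pow_self
  have hR : 1 ≤ 2 ^ ρ := Nat.one_le_two_pow
  have hNQ : 2 * ((n + 1) * ((n + 1) * 2 ^ ρ + 1)) ≤ 2 ^ q := by
    calc 2 * ((n + 1) * ((n + 1) * 2 ^ ρ + 1))
        ≤ 2 * (2 ^ n * (2 ^ n * 2 ^ ρ + 2 ^ n * 2 ^ ρ)) := by
          gcongr
          exact Nat.mul_pos Nat.one_le_two_pow hR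
      _ = 2 ^ q := by rw [hq]; ring
  have hQ : 2 ≤ 2 ^ q := by
    calc 2 = 2 ^ 1 := rfl
      _ ≤ 2 ^ q := Nat.pow_le_pow_right two_pos (by omega)
  have hNR : (n + 1) * 2 ^ ρ + 1 ≤ 2 ^ q := by nlinarith [hNQ]
  have hN : n + 1 ≤ 2 ^ q := by nlinarith
  refine exists_recompilation_aux C d (2 ^ q) (2 ^ ρ) hQ hR hbox ?_ _ ?_ ?_ T Fin.elim0 _
    Set.Subset.rfl (fun V i => i.elim0) (by rwa [cutPolyhedron_elim0])
  · have hQ0 : (0 : ℝ) < (2 ^ q : ℕ) := by exact_mod_cast hQ1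
    rw [mul_div_assoc', mul_div_assoc', div_le_one hQ0]
    have : (((2 * ((n + 1) * ((n + 1) * 2 ^ ρ + 1))) : ℕ) : ℝ) ≤ (2 ^ q : ℕ) := by
      exact_mod_cast hNQ
    push_cast at this ⊢
    linarith
  · rw [pow_mul 2 q]
    generalize 2 ^ q = Q at *
    generalize 2 ^ ρ = R at *
    rw [Nat.cast_le]
    calc ((n + 1) * R * Q ^ (n + 2) + 1) ^ (n + 1) * (Q ^ (n + 2) + (n + 1) * Q ^ (n + 1))
        ≤ (Q ^ (n + 3)) ^ (n + 1) * Q ^ (n + 3) := by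
          gcongr
          · calc (n + 1) * R * Q ^ (n + 2) + 1 ≤ (n + 1) * R * Q ^ (n + 2) + Q ^ (n + 2) := by
                  gcongr
                  exact Nat.one_le_pow _ _ hQ1
              _ = ((n + 1) * R + 1) * Q ^ (n + 2) := by ring
              _ ≤ Q * Q ^ (n + 2) := Nat.mul_le_mul_right _ hNR
              _ = Q ^ (n + 3) := by ring
          · calc Q ^ (n + 2) + (n + 1) * Q ^ (n + 1) ≤ Q ^ (n + 2) + Q * Q ^ (n + 1) := by gcongr
              _ = 2 * Q ^ (n + 2) := by ring
              _ ≤ Q * Q ^ (n + 2) := Nat.mul_le_mul_right _ hQ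
              _ = Q ^ (n + 3) := by ring
      _ = Q ^ ((n + 2) * (n + 3)) := by
          rw [← pow_succ, ← pow_mul]
          congr 1
          ring
  · rw [pow_mul 2 q]
    generalize 2 ^ q = Q at *
    have : Q ^ (n + 1) + 1 ≤ Q ^ ((n + 2) * (n + 3)) := by
      calc Q ^ (n + 1) + 1 ≤ Q ^ (n + 1) + Q ^ (n + 1) := by
            gcongr
            exact Nat.one_le_pow _ _ hQ1
        _ = 2 * Q ^ (n + 1) := by ring
        _ ≤ Q * Q ^ (n + 1) := Nat.mul_le_mul_right _ hQ
        _ = Q ^ (n + 2) := by ring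
        _ ≤ _ := Nat.pow_le_pow_right hQ1 (Nat.le_mul_of_pos_right _ (by omega))
    exact_mod_cast this

/-! ### Branching proofs without repeated inequalities -/

/-- The number of edges on a longest path from the root to a leaf. -/
def BranchTree.depth {n : ℕ} : BranchTree n → ℕ
  | .leaf => 0
  | .node _ _ l r => 1 + max l.depth r.depth

/-- If all inequalities of a branching proof belong to `U`, then omitting repetitions along paths
yields a branching proof of depth at most the cardinality of `U`. -/
theorem exists_pruned {n : ℕ} (B : ℤ) (U : Finset (Ineq n))
    (hU : ∀ (a : Fin n → ℤ) (b : ℤ), (∀ j, |a j| ≤ B) → |b| ≤ B →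
      leftIneq a b ∈ U ∧ rightIneq a b ∈ U) (T : BranchTree n) :
    ∀ (S : Finset (Ineq n)) (K : Set (Fin n → ℝ)), S ⊆ U → (∀ e ∈ S, K ⊆ e.halfspace) →
      T.Bounded B → IsBranchingProof K T →
      ∃ T' : BranchTree n, IsBranchingProof K T' ∧ T'.length ≤ T.length ∧ T'.Bounded B ∧
        S.card + T'.depth ≤ U.card := by
  classical
  induction T with
  | leaf =>
    intro S K hS _ _ hT
    exact ⟨.leaf, hT, le_rfl, trivial, Finset.card_le_card hS⟩
  | node a b l r hl hr =>
    rintro S K hS hK ⟨ha, hb, hlB, hrB⟩ ⟨hTl, hTr⟩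
    obtain ⟨hUl, hUr⟩ := hU a b ha hb
    -- `S` collects inequalities already valid on `K`. If one side of the split is among them,
    -- cutting changes nothing and that child replaces the node; otherwise both children enlarge
    -- `S`.
    by_cases hleft : leftIneq a b ∈ S
    · obtain ⟨T', h1, h2, h3, h4⟩ := hl S K hS hK hlB
        (by rwa [Set.inter_eq_left.2 (hK _ hleft)] at hTl)
      exact ⟨T', h1, h2.trans (by simp only [BranchTree.length]; omega), h3, h4⟩
    by_cases hright : rightIneq a b ∈ S
    · obtain ⟨T', h1, h2, h3, h4⟩ := hr S K hS hK hrB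
        (by rwa [Set.inter_eq_left.2 (hK _ hright)] at hTr)
      exact ⟨T', h1, h2.trans (by simp only [BranchTree.length]; omega), h3, h4⟩
    have hins : ∀ e : Ineq n, ∀ f ∈ insert e S, K ∩ e.halfspace ⊆ f.halfspace := by
      intro e f hf
      rcases Finset.mem_insert.1 hf with rfl | hf
      · exact Set.inter_subset_right
      · exact Set.inter_subset_left.trans (hK f hf)
    obtain ⟨l', l1, l2, l3, l4⟩ := hl _ _ (Finset.insert_subset hUl hS) (hins _) hlB hTl
    obtain ⟨r', r1, r2, r3, r4⟩ := hr _ _ (Finset.insert_subset hUr hS) (hins _) hrB hTr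
    rw [Finset.card_insert_of_notMem hleft] at l4
    rw [Finset.card_insert_of_notMem hright] at r4
    refine ⟨.node a b l' r', ⟨l1, r1⟩, ?_, ⟨ha, hb, l3, r3⟩, ?_⟩
    · simp only [BranchTree.length]; omega
    · simp only [BranchTree.depth]; omega

theorem exists_ineq_finset {n : ℕ} (B : ℕ) :
    ∃ U : Finset (Ineq n), U.card ≤ (2 * (B + 1) + 1) ^ (n + 1) ∧
      ∀ (a : Fin n → ℤ) (b : ℤ), (∀ j, |a j| ≤ B) → |b| ≤ B →
        leftIneq a b ∈ U ∧ rightIneq a b ∈ U := by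
  classical
  let box : Finset (Option (Fin n) → ℤ) :=
    -- The box has radius `B + 1` because a right edge carries the right-hand side `-b - 1`.
    Fintype.piFinset fun _ => Finset.Icc (-((B : ℤ) + 1)) (B + 1)
  have hmem : ∀ e : Ineq n, (∀ j, |e.a j| ≤ B + 1) → |e.b| ≤ B + 1 →
      e ∈ box.image fun p => (⟨fun j => p (some j), p none⟩ : Ineq n) := fun e ha hb => by
    refine Finset.mem_image.2 ⟨e.hom, Fintype.mem_piFinset.2 fun o => ?_, rfl⟩
    rw [Finset.mem_Icc, ← abs_le]
    cases o with
    | none => exact hb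
    | some j => exact ha j
  refine ⟨box.image fun p => ⟨fun j => p (some j), p none⟩, ?_, fun a b ha hb => ⟨?_, ?_⟩⟩
  · refine Finset.card_image_le.trans (le_of_eq ?_)
    simp only [box, Fintype.card_piFinset, Int.card_Icc, Finset.prod_const, Finset.card_univ,
      Fintype.card_option, Fintype.card_fin]
    congr 1
    omega
  · exact hmem _ (fun j => (ha j).trans (by omega)) (hb.trans (by omega))
  · refine hmem _ (fun j => ?_) ?_
    · simp only [rightIneq, Pi.neg_apply, abs_neg]
      exact (ha j).trans (by omega)
    · simp only [rightIneq]
      rw [abs_le] at hb ⊢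
      omega

/-! ### Bit-size of certified branching proofs -/

theorem bitsRat_intCast_le {z : ℤ} {g : ℕ} (h : |z| ≤ (2 ^ g : ℕ)) : bitsRat (z : ℚ) ≤ g + 3 := by
  have h1 : z.natAbs ≤ 2 ^ g := by
    rw [Int.abs_eq_natAbs] at h
    exact_mod_cast h
  have h2 : Nat.clog 2 (z.natAbs + 1) ≤ g + 1 := by
    refine Nat.clog_le_of_le_pow ?_
    have := Nat.one_le_two_pow (n := g)
    rw [pow_succ]
    omega
  have h3 : Nat.clog 2 (1 + 1) ≤ 1 := Nat.clog_le_of_le_pow (by norm_num)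
  simp only [bitsRat, Rat.num_intCast, Rat.den_intCast]
  omega

theorem bitsVec_intCast_le {n : ℕ} {a : Fin n → ℤ} {g : ℕ} (h : ∀ j, |a j| ≤ (2 ^ g : ℕ)) :
    bitsVec (fun j => (a j : ℚ)) ≤ n + n * (g + 3) := by
  refine Nat.add_le_add_left ((Finset.sum_le_card_nsmul _ _ (g + 3) fun j _ =>
    bitsRat_intCast_le (h j)).trans (by simp)) n

theorem Ineq.bits_le {n : ℕ} {e : Ineq n} {g : ℕ} (ha : ∀ j, |e.a j| ≤ (2 ^ g : ℕ))
    (hb : |e.b| ≤ (2 ^ g : ℕ)) : e.bits ≤ (n + 1) * (g + 4) := by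
  have h1 := bitsVec_intCast_le ha
  have h2 := bitsRat_intCast_le hb
  rw [Ineq.bits]
  have h3 : (n + 1) * (g + 4) = n + n * (g + 3) + (g + 3) + 1 := by ring
  omega

theorem bitsSparse_intCast_le {k s P G : ℕ} {lam : Fin k → ℤ} (hk : k ≤ 2 ^ P)
    (hs : (Finset.univ.filter fun i => lam i ≠ 0).card ≤ s) (h0 : ∀ i, 0 ≤ lam i)
    (hG : ∀ i, lam i ≤ (2 ^ G : ℕ)) :
    bitsSparse (fun i => (lam i : ℚ)) ≤ s * (P + G + 7) := by
  have h1 : bitsSparse (fun i => (lam i : ℚ)) =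
      ∑ i ∈ Finset.univ.filter fun i => lam i ≠ 0,
        (1 + bitsRat ((i : ℕ) + 1 : ℚ) + bitsRat (lam i)) := by
    rw [bitsSparse, Finset.sum_filter]
    refine Finset.sum_congr rfl fun i _ => ?_
    by_cases hi : lam i = 0 <;> simp [hi]
  rw [h1]
  refine (Finset.sum_le_card_nsmul _ _ (P + G + 7) fun i _ => ?_).trans ?_
  · have h2 : bitsRat ((i : ℕ) + 1 : ℚ) ≤ P + 3 := by
      have h := bitsRat_intCast_le (z := ((i : ℕ) + 1 : ℤ)) (g := P) (by
        rw [abs_of_nonneg (by positivity)]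
        exact_mod_cast (Nat.succ_le_of_lt i.2).trans hk)
      push_cast at h
      exact h
    have h3 := bitsRat_intCast_le (z := lam i) (g := G) (by
      rw [abs_of_nonneg (h0 i)]
      exact hG i)
    omega
  · rw [smul_eq_mul]
    exact Nat.mul_le_mul_right _ hs

/-- Every node is charged the same amount, the sum of a bound for an inner node with its two edges
and a bound for a leaf. Keeping `m + k + T.depth ≤ 2 ^ P` down the tree ensures that positions fit
into `P` bits. -/
theorem exists_certified {m n : ℕ} (C : Matrix (Fin m) (Fin n) ℚ) (d : Fin m → ℚ) (h M P : ℕ)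
    (hM : bitsMat C ≤ M) (T : BranchTree n) :
    ∀ {k : ℕ} (E : Fin k → Ineq n), (∀ i j, |(E i).a j| ≤ (2 ^ h : ℕ)) →
      IsBranchingProof (cutPolyhedron C d E) T → T.Bounded (2 ^ h : ℕ) →
      m + k + T.depth ≤ 2 ^ P →
      ∃ T' : CertTree n m k, T'.toBranchTree = T ∧ T'.LeavesCertified C d E ∧
        T'.bits ≤ (3 * ((n + 1) * (h + 6)) + 1 +
          (n + 1) * (P + (M + n * (n + h + 2 * M)) + 7)) * T.length := by
  set G := M + n * (n + h + 2 * M) with hG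
  set W := 3 * ((n + 1) * (h + 6)) + 1 + (n + 1) * (P + G + 7) with hW
  induction T with
  | leaf =>
    intro k E hE hT _ hk
    obtain ⟨D, hD, hDb, C', hC', hC'b⟩ := exists_integral_scaling C
    obtain ⟨lam, hlam, hcard, hle⟩ := exists_certificate C d E D hD C' hC'
      (2 ^ (h + 2 * M)) Nat.one_le_two_pow
      (fun i j => (hC'b i j).trans (by
        rw [Nat.cast_le]; exact Nat.pow_le_pow_right two_pos (by omega)))
      (fun i j => (hE i j).trans (by
        rw [Nat.cast_le]; exact Nat.pow_le_pow_right two_pos (by omega))) hT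
    have hlam0 : ∀ i, 0 ≤ lam i := fun i => by
      exact_mod_cast (show (0 : ℚ) ≤ (lam i : ℚ) from hlam.1 i)
    have hlamG : ∀ i, lam i ≤ (2 ^ G : ℕ) := fun i => by
      refine (hle i).trans ?_
      rw [Nat.cast_le, hG, pow_add 2 M, mul_comm n, pow_mul, add_assoc, pow_add 2 n]
      exact Nat.mul_le_mul (hDb.trans (Nat.pow_le_pow_right two_pos hM))
        (Nat.pow_le_pow_left (Nat.mul_le_mul_right _ Nat.lt_two_pow_self) n)
    refine ⟨.leaf fun i => lam i, rfl, hlam, ?_⟩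
    have := bitsSparse_intCast_le (P := P) (by simpa [BranchTree.depth] using hk) hcard hlam0 hlamG
    simp only [CertTree.bits, BranchTree.length, mul_one]
    omega
  | node a b l r hl hr =>
    rintro k E hE ⟨hTl, hTr⟩ ⟨ha, hb, hlB, hrB⟩ hk
    simp only [BranchTree.depth] at hk
    have hE' : ∀ e : Ineq n, (∀ j, |e.a j| ≤ (2 ^ h : ℕ)) → ∀ (i : Fin (k + 1)) j,
        |((Fin.snoc E e : Fin (k + 1) → Ineq n) i).a j| ≤ (2 ^ h : ℕ) := fun e he i j => by
      refine Fin.lastCases ?_ (fun i => ?_) i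
      · rw [Fin.snoc_last]; exact he j
      · rw [Fin.snoc_castSucc]; exact hE i j
    have hra : ∀ j, |(rightIneq a b).a j| ≤ (2 ^ h : ℕ) := fun j => by
      simp only [rightIneq, Pi.neg_apply, abs_neg]
      exact ha j
    obtain ⟨l', l1, l2, l3⟩ := hl (Fin.snoc E (leftIneq a b)) (hE' _ ha)
      (by rw [cutPolyhedron_snoc]; exact hTl) hlB (by omega)
    obtain ⟨r', r1, r2, r3⟩ := hr (Fin.snoc E (rightIneq a b)) (hE' _ hra)
      (by rw [cutPolyhedron_snoc]; exact hTr) hrB (by omega)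
    refine ⟨.node a b l' r', by simp only [CertTree.toBranchTree, l1, r1], ⟨l2, r2⟩, ?_⟩
    have hpow : ((2 ^ h : ℕ) : ℤ) + 1 ≤ (2 ^ (h + 1) : ℕ) := by
      have := Nat.one_le_two_pow (n := h)
      rw [pow_succ]
      exact_mod_cast (by omega)
    have hleft : (leftIneq a b).bits ≤ (n + 1) * (h + 1 + 4) :=
      Ineq.bits_le (fun j => (ha j).trans (by omega)) (hb.trans (by omega))
    have hright : (rightIneq a b).bits ≤ (n + 1) * (h + 1 + 4) :=
      Ineq.bits_le (fun j => (hra j).trans (by omega)) (by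
        simp only [rightIneq]
        rw [abs_le] at hb ⊢
        omega)
    have hnode : bitsVec (fun j => (a j : ℚ)) + bitsRat (b : ℚ) = (leftIneq a b).bits := rfl
    have hexp : W * (1 + l.length + r.length) = W + W * l.length + W * r.length := by ring
    have h6 : (n + 1) * (h + 6) = (n + 1) * (h + 1 + 4) + (n + 1) := by ring
    simp only [CertTree.bits, BranchTree.length]
    rw [hexp, hnode]
    omega

/-- Labels have `h = O(n³L)` bits per entry, and multipliers and positions `O(n⁴L)` each. A leaf
with `n + 1` of them costs `O(n⁵L)`, an inner node `O(n⁴L)`, and there are `O(n |T|)` nodes. -/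
theorem exists_certifiedBranchingProof {m n : ℕ} (hn : 1 ≤ n) (C : Matrix (Fin m) (Fin n) ℚ)
    (d : Fin m → ℚ) (T : BranchTree n) (hbd : Bornology.IsBounded (polyhedron C d))
    (hT : IsBranchingProof (polyhedron C d) T) :
    ∃ T' : CertTree n m 0, IsCertifiedBranchingProof C d T' ∧
      T'.toBranchTree.length ≤ 20000 * n * T.length ∧
      T'.bits ≤ 20000 * n ^ 6 * (bitsMat C + bitsVec d) * T.length := by
  set L := bitsMat C + bitsVec d with hL
  have hm := polyhedron_rows_pos hn C d hbd
  have hmL : m ≤ L := by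
    have : m ≤ bitsVec d := Nat.le_add_right _ _
    omega
  have hnL : n ≤ L := by
    have h1 : n ≤ m * n := Nat.le_mul_of_pos_left n hm
    have h2 : m * n ≤ bitsMat C := Nat.le_add_right _ _
    omega
  obtain ⟨T₁, h1, hlen1, hB1⟩ := exists_recompilation C d (6 * n * L)
    (fun x hx j => abs_le_of_mem_polyhedron hn C d hbd x hx j) T hT
  set h := (2 * n + 6 * n * L + 2) * ((n + 2) * (n + 3)) with hh
  obtain ⟨U, hUcard, hU⟩ := exists_ineq_finset (n := n) (2 ^ h)
  obtain ⟨T₂, h2, hlen2, hB2, hdepth⟩ := exists_pruned _ U hU T₁ ∅ _ (Finset.empty_subset _)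
    (fun e he => absurd he (Finset.notMem_empty e)) hB1 h1
  have hP : m + 0 + T₂.depth ≤ 2 ^ (L + (h + 3) * (n + 1) + 1) := by
    have e1 : m ≤ 2 ^ L := hmL.trans Nat.lt_two_pow_self.le
    have e2 : T₂.depth ≤ 2 ^ ((h + 3) * (n + 1)) := by
      rw [Finset.card_empty, zero_add] at hdepth
      refine hdepth.trans (hUcard.trans ?_)
      rw [pow_mul 2 (h + 3)]
      refine Nat.pow_le_pow_left ?_ _
      have := Nat.one_le_two_pow (n := h)
      rw [pow_add]
      omega
    have e3 : 2 ^ L ≤ 2 ^ (L + (h + 3) * (n + 1)) :=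
      Nat.pow_le_pow_right two_pos (Nat.le_add_right _ _)
    have e4 : 2 ^ ((h + 3) * (n + 1)) ≤ 2 ^ (L + (h + 3) * (n + 1)) :=
      Nat.pow_le_pow_right two_pos (Nat.le_add_left _ _)
    rw [pow_succ]
    omega
  obtain ⟨T', htree, hcert, hbits⟩ := exists_certified C d h L _ (Nat.le_add_right _ _) T₂
    Fin.elim0 (fun i => i.elim0) (by rwa [cutPolyhedron_elim0]) hB2 hP
  have hlen : T₂.length ≤ 9 * n * T.length := by
    refine hlen2.trans (hlen1.trans (Nat.mul_le_mul_right _ (by omega)))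
  refine ⟨T', ⟨by rwa [htree], hcert⟩, ?_, hbits.trans ?_⟩
  · rw [htree]
    exact hlen.trans (Nat.mul_le_mul_right _ (Nat.mul_le_mul_right _ (by norm_num)))
  have hL1 : 1 ≤ L := hn.trans hnL
  have hnL1 : n ≤ n * L := Nat.le_mul_of_pos_right n hL1
  have h1nL : 1 ≤ n * L := hn.trans hnL1
  have hq : 2 * n + 6 * n * L + 2 ≤ 10 * (n * L) := by rw [mul_assoc]; omega
  have hnn : (n + 2) * (n + 3) ≤ 12 * n ^ 2 := by nlinarith
  have hhb : h ≤ 120 * (n ^ 3 * L) :=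
    (Nat.mul_le_mul hq hnn).trans (le_of_eq (by ring))
  have hn2 : n + 1 ≤ 2 * n := by omega
  set Z := n ^ 3 * L with hZ
  have hLZ : L ≤ Z := Nat.le_mul_of_pos_left L (by positivity)
  have hZ1 : 1 ≤ Z := hL1.trans hLZ
  set Y := n * Z with hY
  have hZY : Z ≤ Y := Nat.le_mul_of_pos_left Z hn
  have hP' : L + (h + 3) * (n + 1) + 1 ≤ 248 * Y := by
    have : (h + 3) * (n + 1) ≤ (123 * Z) * (2 * n) := Nat.mul_le_mul (by omega) hn2
    have e : (123 * Z) * (2 * n) = 246 * Y := by rw [hY]; ring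
    omega
  have hG : L + n * (n + h + 2 * L) ≤ 124 * Y := by
    have : n * (n + h + 2 * L) ≤ n * (123 * Z) := Nat.mul_le_mul_left _ (by omega)
    have e : n * (123 * Z) = 123 * Y := by rw [hY]; ring
    omega
  have hYY : Y ≤ n * Y := Nat.le_mul_of_pos_left Y hn
  have hW : 3 * ((n + 1) * (h + 6)) + 1 +
      (n + 1) * (L + (h + 3) * (n + 1) + 1 + (L + n * (n + h + 2 * L)) + 7) ≤ 2000 * (n * Y) := by
    have a1 : (n + 1) * (h + 6) ≤ (2 * n) * (126 * Z) := Nat.mul_le_mul hn2 (by omega)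
    have a2 : (2 * n) * (126 * Z) = 252 * Y := by rw [hY]; ring
    have a3 : (n + 1) * (L + (h + 3) * (n + 1) + 1 + (L + n * (n + h + 2 * L)) + 7) ≤
        (2 * n) * (379 * Y) := Nat.mul_le_mul hn2 (by omega)
    have a4 : (2 * n) * (379 * Y) = 758 * (n * Y) := by ring
    omega
  refine (Nat.mul_le_mul hW hlen).trans ?_
  have : 2000 * (n * Y) * (9 * n * T.length) = 18000 * n ^ 6 * L * T.length := by
    rw [hY, hZ]; ring
  rw [this]
  gcongr
  norm_num

end BranchingProofs

theorem corollary1 :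
    ∃ c : ℕ, ∀ (n m : ℕ) (C : Matrix (Fin m) (Fin n) ℚ) (d : Fin m → ℚ)
      (T : BranchingProofs.BranchTree n),
      1 ≤ n →
      Bornology.IsBounded (BranchingProofs.polyhedron C d) →
      BranchingProofs.IsBranchingProof (BranchingProofs.polyhedron C d) T →
      ∃ T' : BranchingProofs.CertTree n m 0,
        BranchingProofs.IsCertifiedBranchingProof C d T' ∧
        T'.toBranchTree.length ≤ c * n * T.length ∧
        T'.bits ≤
          c * n ^ 6 * (BranchingProofs.bitsMat C + BranchingProofs.bitsVec d) * T.length :=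
  ⟨20000, fun _ _ C d T hn hbd hT =>
    BranchingProofs.exists_certifiedBranchingProof hn C d T hbd hT⟩
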